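/- **Theorem 1.** *Current-state opacity of extended finite automata (EFAs) is undecidable in general, even if the satisfiability of the predicates that occur in the automata is decidable.* An EFA consists of finite sets $Q$ of state tags and $\Sigma$ of event tags, domains $X$ and $Y$ of event and state parameters, initial states $Q_0\subseteq Q$ with initial parameters in $Y_0\subseteq Y$, marked states $Q_m\subseteq Q$, and finitely many symbolic transitions $q\xrightarrow[k]{\sigma:\varphi:\xi}\hat q$, where $k\ge 0$, $\varphi$ is a predicate on $Y\times X^k$ and $\xi:Y\times X^k\to Y$. Such a transition stands for all concrete transitions $(q,b)\to(\hat q,\xi(b,a))$ with event $\sigma\langle a_1,\dots,a_k\rangle$ such that $\varphi(b,a)$ holds. For a parameterized string $u$, the data string $\mathfrak D(u)$ is the sequence of the non-empty parameter tuples of $u$. An observation function $\theta$ is given by a predicate $\vartheta$ on $X$: it erases all data elements that do not satisfy $\vartheta$ and then all empty tuples. Given secret states $Q_s\subseteq Q$ and non-secret states $Q_{ns}\subseteq Q$, the EFA is *current-state opaque* if for every string $u$ leading from an initial state (with parameter in $Y_0$) to $Q_s$ there is a string $v$ leading from an initial state (with parameter in $Y_0$) to $Q_{ns}$ with $\theta(\mathfrak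 D(u))=\theta(\mathfrak D(v))$. Consider the EFAs with four states $q_0,\dots,q_3$, four event tags and $X=Y=\mathbb N^3$ whose predicates ($\varphi$, $Y_0$, $\vartheta$) are Boolean combinations of equations between terms built from the coordinates of the parameters by $0$, successor and if-then-else, and whose updates $\xi$ are triples of such terms. Then: 1. It is decidable, given such a predicate and $k\in\mathbb N$, whether the predicate is satisfiable in $Y\times X^k$. 2. It is undecidable, given such an EFA, $Q_s$, $Q_{ns}$ and $\vartheta$, whether the EFA is current-state opaque. 3. It remains undecidable if all transitions have step-length $k=1$, $Q_0=\{q_0\}$, $Q_s=\{q_0,q_1,q_2\}$, $Q_{ns}=\{q_3\}$, and the observation function is trivial ($\theta\equiv\epsilon$, nothing is observable). 4. There is a computable map from programs $P$ of two-counter machines to instances $E_P$ of the kind in 3 such that $P$ halts if and only if $q_3$ is reachable in $E_P$, and if and only if $E_P$ is current-state opaque. Here a two-counter machine has two registers with values in $\mathbb N$ and the instructions $INC(r_j)$, $DEC(r_j)$ (which cannot be executed if $r_j=0$), $JZ(r_j,z)$ (go to instruction $z$ if $r_j=0$, else to the next one) and an unconditional jump to instruction $z$; it starts at its first instruction with both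 registers $0$, and halts when the program counter is not the number of an instruction. -/

import Mathlib

/-! ### Extended finite automata, their languages and current-state opacity -/

/-- A symbolic transition `src --(tag : guard : upd)--> tgt` of step-length `k`.  The event carries a
`k`-tuple of event parameters in `X`; the states carry a parameter in `Y`. -/
structure SymTransition (Q S X Y : Type) where
  src : Q
  tgt : Q
  k : ℕ
  tag : S
  guard : Y → (Fin k → X) → Prop
  upd : Y → (Fin k → X) → Y

/-- Extended finite automata with state tags `Q`, event tags `S`, event parameters in `X` and state
parameters in `Y`. -/
structure EFA (Q S X Y : Type) where
  init : Set Q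
  marked : Set Q
  initParam : Set Y
  trans : Set (SymTransition Q S X Y)
  finite_states : Finite Q
  finite_tags : Finite S
  finite_trans : trans.Finite

/-- A parameterized event `σ⟨a₁, …, a_k⟩`. -/
abbrev ParamEvent (S X : Type) := S × List X

namespace EFA

variable {Q S X Y : Type}

/-- The concrete transition `(q, b) --v--> (q', b')`. -/
def Step (E : EFA Q S X Y) (p : Q × Y) (v : ParamEvent S X) (p' : Q × Y) : Prop :=
  ∃ r ∈ E.trans, ∃ a : Fin r.k → X,
    p.1 = r.src ∧ p'.1 = r.tgt ∧ v = (r.tag, List.ofFn a) ∧ r.guard p.2 a ∧ p'.2 = r.upd p.2 a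

/-- The combined concrete transition `p --u--> p'` along a parameterized string.  The empty string
stands for the implicit `ε`-selfloops. -/
inductive Path (E : EFA Q S X Y) : Q × Y → List (ParamEvent S X) → Q × Y → Prop
  | nil (p : Q × Y) : Path E p [] p
  | cons {p p' p'' : Q × Y} {v : ParamEvent S X} {u : List (ParamEvent S X)} :
      E.Step p v p' → Path E p' u p'' → Path E p (v :: u) p''

/-- The language between a set of source states and a set of target states. -/
def lang (E : EFA Q S X Y) (Q₁ Q₂ : Set Q) : Set (List (ParamEvent S X)) :=
  {u | ∃ q₁ ∈ Q₁, ∃ q₂ ∈ Q₂, ∃ b₁ b₂ : Y,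
    E.Path (q₁, b₁) u (q₂, b₂) ∧ (q₁ ∈ E.init → b₁ ∈ E.initParam)}

/-- The state `q` is reachable from the initial states. -/
def Reachable (E : EFA Q S X Y) (q : Q) : Prop :=
  (E.lang E.init {q}).Nonempty

/-- The data string of a parameterized string: event tags are stripped, and events without
parameters disappear. -/
def dataString (u : List (ParamEvent S X)) : List (List X) :=
  (u.map Prod.snd).filter (fun a => !a.isEmpty)

open Classical in
/-- The observation of a data string under the static observation function given by the set `vis` of
observable data elements: unobservable elements are erased from every tuple, and tuples that
become empty are removed. -/
noncomputable def observe (vis : Set X) (d : List (List X)) : List (List X) :=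
  (d.map (fun a => a.filter (fun x => decide (x ∈ vis)))).filter (fun a => !a.isEmpty)

/-- Current-state opacity with respect to the secret states `Qs`, the non-secret states `Qns` and the
observation function given by `vis`. -/
def CurrentStateOpaque (E : EFA Q S X Y) (Qs Qns : Set Q) (vis : Set X) : Prop :=
  ∀ u ∈ E.lang E.init Qs, ∃ v ∈ E.lang E.init Qns,
    observe vis (dataString u) = observe vis (dataString v)

end EFA

/-! ### The predicate language: quantifier-free formulas over `0`, successor, equality and if-then-else

The terms and formulas are in bijection with `ℕ` (by the usual pairing function), so that
algorithms can take them as inputs. -/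

/-- Terms in the variables `v₀, v₁, …`; `ifEq s t a b` is `if s = t then a else b`.  An if-then-else
on a Boolean combination of equations is obtained by nesting. -/
inductive Term where
  | zero : Term
  | var : ℕ → Term
  | succ : Term → Term
  | ifEq : Term → Term → Term → Term → Term

namespace Term

def eval (v : ℕ → ℕ) : Term → ℕ
  | zero => 0
  | var n => v n
  | succ t => t.eval v + 1
  | ifEq s t a b => if s.eval v = t.eval v then a.eval v else b.eval v

def toNat : Term → ℕ
  | zero => 0
  | var n => 3 * n + 1
  | succ t => 3 * t.toNat + 2
  | ifEq s t a b => 3 * Nat.pair (Nat.pair s.toNat t.toNat) (Nat.pair a.toNat b.toNat) + 3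

def ofNat : ℕ → Term
  | 0 => zero
  | n + 1 =>
    have hm : n / 3 < n + 1 := Nat.lt_succ_of_le (Nat.div_le_self n 3)
    have _h1 : (n / 3).unpair.1.unpair.1 < n + 1 :=
      lt_of_le_of_lt ((Nat.unpair_left_le _).trans (Nat.unpair_left_le _)) hm
    have _h2 : (n / 3).unpair.1.unpair.2 < n + 1 :=
      lt_of_le_of_lt ((Nat.unpair_right_le _).trans (Nat.unpair_left_le _)) hm
    have _h3 : (n / 3).unpair.2.unpair.1 < n + 1 :=
      lt_of_le_of_lt ((Nat.unpair_left_le _).trans (Nat.unpair_right_le _)) hm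
    have _h4 : (n / 3).unpair.2.unpair.2 < n + 1 :=
      lt_of_le_of_lt ((Nat.unpair_right_le _).trans (Nat.unpair_right_le _)) hm
    match n % 3 with
    | 0 => var (n / 3)
    | 1 => succ (ofNat (n / 3))
    | _ => ifEq (ofNat (n / 3).unpair.1.unpair.1) (ofNat (n / 3).unpair.1.unpair.2)
        (ofNat (n / 3).unpair.2.unpair.1) (ofNat (n / 3).unpair.2.unpair.2)
termination_by n => n
decreasing_by all_goals assumption

theorem ofNat_toNat (t : Term) : ofNat t.toNat = t := by
  induction t with
  | zero => simp [toNat, ofNat]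
  | var n =>
    have h1 : 3 * n / 3 = n := by omega
    have h2 : 3 * n % 3 = 0 := by omega
    simp [toNat, ofNat, h1, h2]
  | succ t ih =>
    have h1 : (3 * t.toNat + 1) / 3 = t.toNat := by omega
    have h2 : (3 * t.toNat + 1) % 3 = 1 := by omega
    simp [toNat, ofNat, h1, h2, ih]
  | ifEq s t a b hs ht ha hb =>
    have h1 : ∀ k, (3 * k + 2) / 3 = k := by intro k; omega
    have h2 : ∀ k, (3 * k + 2) % 3 = 2 := by intro k; omega
    simp [toNat, ofNat, h1, h2, hs, ht, ha, hb]

theorem toNat_ofNat (n : ℕ) : (ofNat n).toNat = n := by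
  induction n using Nat.strong_induction_on with
  | _ n ih =>
    cases n with
    | zero => simp [ofNat, toNat]
    | succ n =>
      have hm : n / 3 < n + 1 := Nat.lt_succ_of_le (Nat.div_le_self n 3)
      have h1 := ih _ (lt_of_le_of_lt
        ((Nat.unpair_left_le _).trans (Nat.unpair_left_le (n / 3))) hm)
      have h2 := ih _ (lt_of_le_of_lt
        ((Nat.unpair_right_le _).trans (Nat.unpair_left_le (n / 3))) hm)
      have h3 := ih _ (lt_of_le_of_lt
        ((Nat.unpair_left_le _).trans (Nat.unpair_right_le (n / 3))) hm)
      have h4 := ih _ (lt_of_le_of_lt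
        ((Nat.unpair_right_le _).trans (Nat.unpair_right_le (n / 3))) hm)
      have h0 := ih _ hm
      have hlt : n % 3 < 3 := Nat.mod_lt _ (by norm_num)
      rw [ofNat]
      rcases hk : n % 3 with _ | _ | k
      · simp only [toNat]; omega
      · simp only [toNat, h0]; omega
      · simp only [toNat, h1, h2, h3, h4, Nat.pair_unpair]; omega

instance : Denumerable Term :=
  Denumerable.mk' ⟨toNat, ofNat, ofNat_toNat, toNat_ofNat⟩

instance : Primcodable Term := Primcodable.ofDenumerable Term

end Term

/-- Boolean combinations of equations between terms. -/
inductive Formula where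
  | eq : Term → Term → Formula
  | neg : Formula → Formula
  | and : Formula → Formula → Formula

namespace Formula

def Holds (v : ℕ → ℕ) : Formula → Prop
  | eq s t => s.eval v = t.eval v
  | neg φ => ¬ φ.Holds v
  | and φ ψ => φ.Holds v ∧ ψ.Holds v

def toNat : Formula → ℕ
  | eq s t => 3 * Nat.pair s.toNat t.toNat
  | neg φ => 3 * φ.toNat + 1
  | and φ ψ => 3 * Nat.pair φ.toNat ψ.toNat + 2

def ofNat (n : ℕ) : Formula :=
  match h : n % 3 with
  | 0 => eq (Term.ofNat (n / 3).unpair.1) (Term.ofNat (n / 3).unpair.2)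
  | 1 =>
    have : n / 3 < n := by omega
    neg (ofNat (n / 3))
  | k + 2 =>
    have h0 : n / 3 < n := by omega
    have h1 : (n / 3).unpair.1 < n := lt_of_le_of_lt (Nat.unpair_left_le _) h0
    have h2 : (n / 3).unpair.2 < n := lt_of_le_of_lt (Nat.unpair_right_le _) h0
    and (ofNat (n / 3).unpair.1) (ofNat (n / 3).unpair.2)
termination_by n

theorem ofNat_toNat (φ : Formula) : ofNat φ.toNat = φ := by
  induction φ with
  | eq s t =>
    have h1 : ∀ k, 3 * k / 3 = k := by intro k; omega
    rw [ofNat]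
    split <;> rename_i h <;> simp only [toNat] at h ⊢
    · simp [h1, Term.ofNat_toNat]
    · omega
    · omega
  | neg φ ih =>
    have h1 : ∀ k, (3 * k + 1) / 3 = k := by intro k; omega
    rw [ofNat]
    split <;> rename_i h <;> simp only [toNat] at h ⊢
    · omega
    · simp [h1, ih]
    · omega
  | and φ ψ hφ hψ =>
    have h1 : ∀ k, (3 * k + 2) / 3 = k := by intro k; omega
    rw [ofNat]
    split <;> rename_i h <;> simp only [toNat] at h ⊢
    · omega
    · omega
    · simp [h1, hφ, hψ]

theorem toNat_ofNat (n : ℕ) : (ofNat n).toNat = n := by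
  induction n using Nat.strong_induction_on with
  | _ n ih =>
    rw [ofNat]
    split <;> rename_i h
    · simp only [toNat, Term.toNat_ofNat, Nat.pair_unpair]; omega
    · have h0 : n / 3 < n := by omega
      simp only [toNat, ih _ h0]; omega
    · have h0 : n / 3 < n := by omega
      have h1 := ih _ (lt_of_le_of_lt (Nat.unpair_left_le (n / 3)) h0)
      have h2 := ih _ (lt_of_le_of_lt (Nat.unpair_right_le (n / 3)) h0)
      simp only [toNat, h1, h2, Nat.pair_unpair]; omega

instance : Denumerable Formula :=
  Denumerable.mk' ⟨toNat, ofNat, ofNat_toNat, toNat_ofNat⟩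

instance : Primcodable Formula := Primcodable.ofDenumerable Formula

end Formula

/-! ### Finite descriptions of automata whose parameter domains are both `ℕ³` -/

/-- Triples of natural numbers, the domain of all parameters. -/
abbrev Triple := Fin 3 → ℕ

/-- The valuation given by a state parameter `b` and event parameters `a₀, …, a_{k-1}`: the variables
`v₀, v₁, v₂` are the entries of `b`, and `v_{3(i+1)}, v_{3(i+1)+1}, v_{3(i+1)+2}` those of `a i`.
Variables beyond these are read as `0`. -/
def valuation {k : ℕ} (b : Triple) (a : Fin k → Triple) : ℕ → ℕ := fun n =>
  if h : n / 3 < k + 1 then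
    (Fin.cons b a : Fin (k + 1) → Triple) ⟨n / 3, h⟩ ⟨n % 3, Nat.mod_lt n (by norm_num)⟩
  else 0

/-- The denotation of a formula as a predicate on state parameter and `k` event parameters. -/
def Formula.guard (φ : Formula) (k : ℕ) (b : Triple) (a : Fin k → Triple) : Prop :=
  φ.Holds (valuation b a)

/-- The denotation of a formula as a predicate on a single triple. -/
def Formula.den (φ : Formula) : Set Triple :=
  {b | φ.Holds (valuation b Fin.elim0)}

/-- Satisfiability of a formula as a predicate on state parameter and `k` event parameters. -/
def Formula.IsSat (φ : Formula) (k : ℕ) : Prop :=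
  ∃ (b : Triple) (a : Fin k → Triple), φ.guard k b a

/-- Description of a symbolic transition with `n` state tags and `m` event tags; `upd j` describes the
`j`-th entry of the new state parameter. -/
structure TransitionCode (n m : ℕ) where
  src : Fin n
  tgt : Fin n
  k : ℕ
  tag : Fin m
  guard : Formula
  upd : Fin 3 → Term

/-- Input of the opacity problem: an automaton with `n` state tags and `m` event tags, a set of secret
states, a set of non-secret states, and the predicate that selects the observable elements. -/
structure OpacityInstance (n m : ℕ) where
  init : List (Fin n)
  marked : List (Fin n)
  initParam : Formula
  trans : List (TransitionCode n m)
  secret : List (Fin n)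
  nonSecret : List (Fin n)
  observable : Formula

namespace TransitionCode

variable {n m : ℕ}

def equivProd : TransitionCode n m ≃
    Fin n × Fin n × ℕ × Fin m × Formula × (Fin 3 → Term) where
  toFun t := (t.src, t.tgt, t.k, t.tag, t.guard, t.upd)
  invFun p := ⟨p.1, p.2.1, p.2.2.1, p.2.2.2.1, p.2.2.2.2.1, p.2.2.2.2.2⟩
  left_inv _ := rfl
  right_inv _ := rfl

instance : Primcodable (TransitionCode n m) := Primcodable.ofEquiv _ equivProd

def toSym (t : TransitionCode n m) : SymTransition (Fin n) (Fin m) Triple Triple where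
  src := t.src
  tgt := t.tgt
  k := t.k
  tag := t.tag
  guard := t.guard.guard t.k
  upd b a := fun j => (t.upd j).eval (valuation b a)

end TransitionCode

namespace OpacityInstance

variable {n m : ℕ}

def equivProd : OpacityInstance n m ≃
    List (Fin n) × List (Fin n) × Formula × List (TransitionCode n m) ×
      List (Fin n) × List (Fin n) × Formula where
  toFun I := (I.init, I.marked, I.initParam, I.trans, I.secret, I.nonSecret, I.observable)
  invFun p := ⟨p.1, p.2.1, p.2.2.1, p.2.2.2.1, p.2.2.2.2.1, p.2.2.2.2.2.1, p.2.2.2.2.2.2⟩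
  left_inv _ := rfl
  right_inv _ := rfl

instance : Primcodable (OpacityInstance n m) := Primcodable.ofEquiv _ equivProd

/-- The automaton described by an instance. -/
def toEFA (I : OpacityInstance n m) : EFA (Fin n) (Fin m) Triple Triple where
  init := {q | q ∈ I.init}
  marked := {q | q ∈ I.marked}
  initParam := I.initParam.den
  trans := TransitionCode.toSym '' {t | t ∈ I.trans}
  finite_states := inferInstance
  finite_tags := inferInstance
  finite_trans := (List.finite_toSet I.trans).image _

/-- The automaton described by the instance is current-state opaque with respect to the secret states,
the non-secret states and the observation function of the instance. -/
def Opaque (I : OpacityInstance n m) : Prop :=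
  I.toEFA.CurrentStateOpaque {q | q ∈ I.secret} {q | q ∈ I.nonSecret} I.observable.den

/-- Four-state instances of a very simple shape: every transition has step-length one, the only
initial state is `q₀`, the secret states are `q₀, q₁, q₂`, the only non-secret state is `q₃`,
and nothing is observable (the observation function is constantly `ε`). -/
def IsSimple {m : ℕ} (I : OpacityInstance 4 m) : Prop :=
  (∀ t ∈ I.trans, t.k = 1) ∧ {q | q ∈ I.init} = {0} ∧ {q | q ∈ I.secret} = {0, 1, 2} ∧
    {q | q ∈ I.nonSecret} = {3} ∧ I.observable.den = ∅

end OpacityInstance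

/-! ### Two-counter machines -/

/-- Instructions of two-counter machines: increment, decrement, jump if zero, and unconditional jump.
(With only two registers and no unconditional jump, a jump would always need an empty register, and
halting would be decidable.) -/
inductive CMInstr where
  | inc : Fin 2 → CMInstr
  | dec : Fin 2 → CMInstr
  | jz : Fin 2 → ℕ → CMInstr
  | jmp : ℕ → CMInstr

def CMInstr.equivSum : CMInstr ≃ Fin 2 ⊕ Fin 2 ⊕ (Fin 2 × ℕ) ⊕ ℕ where
  toFun
    | .inc j => .inl j
    | .dec j => .inr (.inl j)
    | .jz j z => .inr (.inr (.inl (j, z)))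
    | .jmp z => .inr (.inr (.inr z))
  invFun
    | .inl j => .inc j
    | .inr (.inl j) => .dec j
    | .inr (.inr (.inl (j, z))) => .jz j z
    | .inr (.inr (.inr z)) => .jmp z
  left_inv i := by cases i <;> rfl
  right_inv s := by rcases s with j | j | ⟨j, z⟩ | z <;> rfl

instance : Primcodable CMInstr := Primcodable.ofEquiv _ CMInstr.equivSum

/-- A program; its instructions are numbered from `1`. -/
abbrev CMProgram := List CMInstr

namespace CMProgram

/-- The instruction with number `i`, if `1 ≤ i ≤ |P|`. -/
def instrAt (P : CMProgram) (i : ℕ) : Option CMInstr :=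
  if i = 0 then none else P[i - 1]?

/-- The effect of one instruction on configurations `(r₁, r₂, c)`, from `y` to `x`.  A decrement is
not possible when the register is zero. -/
def Exec (y x : Triple) : CMInstr → Prop
  | .inc j => x j.castSucc = y j.castSucc + 1 ∧ x j.rev.castSucc = y j.rev.castSucc ∧
      x 2 = y 2 + 1
  | .dec j => x j.castSucc + 1 = y j.castSucc ∧ x j.rev.castSucc = y j.rev.castSucc ∧
      x 2 = y 2 + 1
  | .jz j z => x 0 = y 0 ∧ x 1 = y 1 ∧ x 2 = if y j.castSucc = 0 then z else y 2 + 1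
  | .jmp z => x 0 = y 0 ∧ x 1 = y 1 ∧ x 2 = z

/-- One computation step. -/
def Step (P : CMProgram) (y x : Triple) : Prop :=
  ∃ ι, P.instrAt (y 2) = some ι ∧ Exec y x ι

/-- The machine, started at its first instruction with both registers zero, reaches a configuration
whose program counter is not the number of an instruction. -/
def Halts (P : CMProgram) : Prop :=
  ∃ x : Triple, Relation.ReflTransGen (Step P) ![0, 0, 1] x ∧ P.instrAt (x 2) = none

end CMProgram

/-! Satisfiability is decidable by a small model property. A term evaluates to a variable value or
`0`, plus a number of successors bounded by the code of the term, so a formula only tests equations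
`s + c = t + d` with small `c` and `d`. Such tests do not notice when long gaps between the values
of the variables are shortened (`collapse_add_eq_iff`). A satisfiable formula therefore has a model
below an explicit bound, and evaluating a formula is primitive recursive, so a bounded search
decides.

Undecidability comes from counter machines. At `q₀` the state parameter holds a configuration, the
event parameter guesses the next one, and the guard checks the guess; an edge to `q₃` opens exactly
when the program counter leaves the program. Nothing is observable, so all strings look alike, and
the empty string already leads to the secret state `q₀`. Opacity then says only that some string
leads to `q₃`, that is, that the machine halts (`halts_iff_reachable`, `reachable_iff_opaque`).

It remains to see that halting of two-counter machines started with empty registers is undecidable.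
Following Minsky, one counter holds a Gödel number `∏ pᵢ ^ σᵢ` of arbitrarily many registers and the
other is scratch space. Incrementing a register is multiplication by a prime; testing and
decrementing is division by it. Structured blocks of such code compute every primitive recursive
function (`exists_computes`). An unbounded search around the block for the step-bounded evaluator
`Code.evaln` halts iff a given partial recursive code halts on input `0`. The code number `n` enters
through a prefix of the computation that loads `2 ^ n`, and this makes the reduction computable. -/

/-! ### A small model property -/

/-- Shrinks the gaps between consecutive elements of `S` to at most `D + 1`. -/
def collapse (S : Finset ℕ) (D x : ℕ) : ℕ :=
  ((Finset.range x).filter fun y => ∃ s ∈ S, s ≤ y ∧ y ≤ s + D).card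

section Collapse

variable {S : Finset ℕ} {D : ℕ}

theorem collapse_le (x : ℕ) : collapse S D x ≤ S.card * (D + 1) := by
  have hsub : ((Finset.range x).filter fun y => ∃ s ∈ S, s ≤ y ∧ y ≤ s + D) ⊆
      S.biUnion fun s => Finset.Icc s (s + D) := by
    intro y hy
    simpa using (Finset.mem_filter.1 hy).2
  refine (Finset.card_le_card hsub).trans (Finset.card_biUnion_le_card_mul _ _ _ ?_)
  intro s _
  simp only [Nat.card_Icc]
  omega

theorem collapse_mono {x y : ℕ} (h : x ≤ y) : collapse S D x ≤ collapse S D y :=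
  Finset.card_le_card (Finset.filter_subset_filter _ (Finset.range_subset_range.2 h))

theorem collapse_zero : collapse S D 0 = 0 := by simp [collapse]

/-- All of `s, …, s + D` are counted, so `collapse` advances in unit steps up to `s + D + 1`. -/
theorem collapse_add {s : ℕ} (hs : s ∈ S) {c : ℕ} (hc : c ≤ D + 1) :
    collapse S D (s + c) = collapse S D s + c := by
  induction c with
  | zero => simp
  | succ c ih =>
    have hmem : ∃ s' ∈ S, s' ≤ s + c ∧ s + c ≤ s' + D := ⟨s, hs, by omega, by omega⟩
    have h1 : collapse S D (s + c + 1) = collapse S D (s + c) + 1 := by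
      unfold collapse
      rw [Finset.range_add_one, Finset.filter_insert, if_pos hmem, Finset.card_insert_of_notMem]
      simp
    rw [← add_assoc, h1, ih (by omega), add_assoc]

/-- A gap of at most `D + 1` is preserved exactly. A longer gap keeps length at least `D + 1 > c`,
so both equations fail. -/
theorem collapse_add_eq_iff_of_le {s t c d : ℕ} (hs : s ∈ S) (hc : c ≤ D) (hst : s ≤ t) :
    s + c = t + d ↔ collapse S D s + c = collapse S D t + d := by
  obtain ⟨e, rfl⟩ := Nat.exists_eq_add_of_le hst
  by_cases he : e ≤ D + 1
  · rw [collapse_add hs he]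
    omega
  · have h1 := collapse_mono (S := S) (D := D) (show s + (D + 1) ≤ s + e by omega)
    rw [collapse_add hs le_rfl] at h1
    omega

theorem collapse_add_eq_iff {s t c d : ℕ} (hs : s ∈ S) (ht : t ∈ S) (hc : c ≤ D) (hd : d ≤ D) :
    s + c = t + d ↔ collapse S D s + c = collapse S D t + d := by
  rcases le_total s t with h | h
  · exact collapse_add_eq_iff_of_le hs hc h
  · rw [eq_comm, collapse_add_eq_iff_of_le ht hd h, eq_comm]

/-- Collapsing preserves the outcome of every test in the term, so both evaluations take the same
branches and end with the same base point `s` and the same number `c` of successors. -/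
theorem Term.eval_collapse {v : ℕ → ℕ} (h0 : 0 ∈ S) (hv : ∀ n, v n ∈ S) (t : Term)
    (ht : t.toNat ≤ D) :
    ∃ s ∈ S, ∃ c ≤ D, t.eval v = s + c ∧ t.eval (collapse S D ∘ v) = collapse S D s + c := by
  -- The successor case raises the offset by one, so the induction needs the bound by the term's own
  -- code in place of the fixed `D`.
  suffices H : ∃ s ∈ S, ∃ c ≤ t.toNat,
      t.eval v = s + c ∧ t.eval (collapse S D ∘ v) = collapse S D s + c by
    obtain ⟨s, hs, c, hc, h⟩ := H
    exact ⟨s, hs, c, hc.trans ht, h⟩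
  induction t with
  | zero => exact ⟨0, h0, 0, by simp, by simp [eval], by simp [eval, collapse_zero]⟩
  | var n => exact ⟨v n, hv n, 0, by simp, by simp [eval], by simp [eval]⟩
  | succ t ih =>
    simp only [toNat] at ht ⊢
    obtain ⟨s, hs, c, hc, h1, h2⟩ := ih (by omega)
    exact ⟨s, hs, c + 1, by omega, by simp [eval, h1, add_assoc], by simp [eval, h2, add_assoc]⟩
  | ifEq p q a b hp hq ha hb =>
    simp only [toNat] at ht ⊢
    have l1 := Nat.left_le_pair (Nat.pair p.toNat q.toNat) (Nat.pair a.toNat b.toNat)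
    have l2 := Nat.right_le_pair (Nat.pair p.toNat q.toNat) (Nat.pair a.toNat b.toNat)
    have l3 := Nat.left_le_pair p.toNat q.toNat
    have l4 := Nat.right_le_pair p.toNat q.toNat
    have l5 := Nat.left_le_pair a.toNat b.toNat
    have l6 := Nat.right_le_pair a.toNat b.toNat
    obtain ⟨s, hs, c, hc, p1, p2⟩ := hp (by omega)
    obtain ⟨t, ht, d, hd, q1, q2⟩ := hq (by omega)
    obtain ⟨x, hx, e, he, a1, a2⟩ := ha (by omega)
    obtain ⟨y, hy, f, hf, b1, b2⟩ := hb (by omega)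
    have key := collapse_add_eq_iff (D := D) hs ht (show c ≤ D by omega) (show d ≤ D by omega)
    by_cases h : s + c = t + d
    · refine ⟨x, hx, e, by omega, ?_, ?_⟩
      · rw [eval, p1, q1, if_pos h, a1]
      · rw [eval, p2, q2, if_pos (key.1 h), a2]
    · refine ⟨y, hy, f, by omega, ?_, ?_⟩
      · rw [eval, p1, q1, if_neg h, b1]
      · rw [eval, p2, q2, if_neg (fun h' => h (key.2 h')), b2]

theorem Formula.holds_collapse {v : ℕ → ℕ} (h0 : 0 ∈ S) (hv : ∀ n, v n ∈ S) (φ : Formula)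
    (hφ : φ.toNat ≤ D) : φ.Holds (collapse S D ∘ v) ↔ φ.Holds v := by
  induction φ with
  | eq s t =>
    simp only [toNat] at hφ
    have l3 := Nat.left_le_pair s.toNat t.toNat
    have l4 := Nat.right_le_pair s.toNat t.toNat
    obtain ⟨x, hx, c, hc, p1, p2⟩ := s.eval_collapse h0 hv (D := D) (by omega)
    obtain ⟨y, hy, d, hd, q1, q2⟩ := t.eval_collapse h0 hv (D := D) (by omega)
    rw [Holds, Holds, p1, p2, q1, q2, collapse_add_eq_iff hx hy hc hd]
  | neg φ ih =>
    simp only [toNat] at hφ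
    rw [Holds, Holds, ih (by omega)]
  | and φ ψ h1 h2 =>
    simp only [toNat] at hφ
    have l3 := Nat.left_le_pair φ.toNat ψ.toNat
    have l4 := Nat.right_le_pair φ.toNat ψ.toNat
    rw [Holds, Holds, h1 (by omega), h2 (by omega)]

end Collapse

/-- The valuation whose first `N` values are the digits of `w` in base `B`. -/
def digitValuation (B N w n : ℕ) : ℕ := if n < N then w / B ^ n % B else 0

/-- Packs a bounded assignment into one number, so that the search for a model runs over a single
bounded variable. -/
theorem exists_digits {B : ℕ} (N : ℕ) (u : ℕ → ℕ) (hu : ∀ n, u n < B) :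
    ∃ w < B ^ N, ∀ n < N, w / B ^ n % B = u n := by
  induction N generalizing u with
  | zero => exact ⟨0, by simp, by simp⟩
  | succ N ih =>
    obtain ⟨w, hw, h⟩ := ih (fun n => u (n + 1)) (fun n => hu _)
    have hB : 0 < B := (Nat.zero_le _).trans_lt (hu 0)
    refine ⟨u 0 + B * w, ?_, ?_⟩
    · have h1 : B * (w + 1) ≤ B * B ^ N := Nat.mul_le_mul_left _ hw
      have h2 := hu 0
      rw [pow_succ']
      rw [mul_add, mul_one] at h1
      omega
    · intro n hn
      cases n with
      | zero => simp [Nat.mod_eq_of_lt (hu 0)]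
      | succ n =>
        rw [pow_succ', ← Nat.div_div_eq_div_mul, Nat.add_mul_div_left _ _ hB,
          Nat.div_eq_of_lt (hu 0), zero_add]
        exact h n (by omega)

/-- Cutting an assignment into consecutive triples recovers the parameters; thus a model found by
the search really comes from some `b` and `a`. -/
theorem valuation_eq_self {k : ℕ} {v : ℕ → ℕ} (hv : ∀ n, 3 * (k + 1) ≤ n → v n = 0) :
    valuation (fun j => v j) (fun (i : Fin k) j => v (3 * (i + 1) + j)) = v := by
  funext n
  unfold valuation
  split_ifs with h
  · obtain ⟨m, hm⟩ : ∃ m, n / 3 = m := ⟨_, rfl⟩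
    have hn : n = 3 * m + n % 3 := by omega
    cases m with
    | zero =>
      have : (⟨n / 3, h⟩ : Fin (k + 1)) = 0 := by ext; simpa using hm
      rw [this, Fin.cons_zero]
      show v (n % 3) = v n
      congr 1
      omega
    | succ m =>
      have : (⟨n / 3, h⟩ : Fin (k + 1)) = Fin.succ ⟨m, by omega⟩ := by ext; simpa using hm
      rw [this, Fin.cons_succ]
      show v (3 * (m + 1) + n % 3) = v n
      congr 1
      omega
  · exact (hv n (by omega)).symm

namespace Formula

/-- A bound for the values in a smallest model. -/
def base (φ : Formula) (k : ℕ) : ℕ := (3 * (k + 1) + 1) * (φ.toNat + 1) + 1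

theorem isSat_iff_exists_digits (φ : Formula) (k : ℕ) :
    φ.IsSat k ↔ ∃ w < φ.base k ^ (3 * (k + 1)),
      φ.Holds (digitValuation (φ.base k) (3 * (k + 1)) w) := by
  constructor
  · rintro ⟨b, a, h⟩
    set v := valuation b a with hvdef
    have hv0 : ∀ n, 3 * (k + 1) ≤ n → v n = 0 := by
      intro n hn
      rw [hvdef, valuation, dif_neg (by omega)]
    -- Zero is included as the value of the term `0` and of all variables out of range. The
    -- resulting size bound `3 * (k + 1) + 1` is the first factor in `base`.
    set S : Finset ℕ := insert 0 ((Finset.range (3 * (k + 1))).image v) with hS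
    have hcard : S.card ≤ 3 * (k + 1) + 1 :=
      (Finset.card_insert_le _ _).trans
        (Nat.succ_le_succ (Finset.card_image_le.trans (by simp)))
    have h0 : 0 ∈ S := Finset.mem_insert_self _ _
    have hv : ∀ n, v n ∈ S := by
      intro n
      by_cases hn : n < 3 * (k + 1)
      · exact Finset.mem_insert_of_mem (Finset.mem_image_of_mem _ (Finset.mem_range.2 hn))
      · rw [hv0 n (by omega)]
        exact h0
    have hlt : ∀ n, (collapse S φ.toNat ∘ v) n < φ.base k := fun n =>
      Nat.lt_succ_of_le ((collapse_le _).trans (Nat.mul_le_mul_right _ hcard))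
    obtain ⟨w, hw, hd⟩ := exists_digits (3 * (k + 1)) _ hlt
    refine ⟨w, hw, ?_⟩
    have : digitValuation (φ.base k) (3 * (k + 1)) w = collapse S φ.toNat ∘ v := by
      funext n
      unfold digitValuation
      split_ifs with hn
      · exact hd n hn
      · simp [hv0 n (by omega), collapse_zero]
    rw [this, holds_collapse h0 hv φ le_rfl]
    exact h
  · rintro ⟨w, -, h⟩
    set v := digitValuation (φ.base k) (3 * (k + 1)) w with hv
    refine ⟨fun j => v j, fun i j => v (3 * (i + 1) + j), ?_⟩
    rw [guard, valuation_eq_self]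
    · exact h
    · intro n hn
      exact if_neg (by omega)

end Formula

/-! ### Evaluation of terms and formulas is primitive recursive -/

section Eval

variable {α : Type} [Primcodable α]

theorem Term.encode_eq (t : Term) : Encodable.encode t = t.toNat := rfl

theorem Formula.encode_eq (φ : Formula) : Encodable.encode φ = φ.toNat := rfl

theorem getD_map_range {β : Type} (f : ℕ → β) (d : β) {n i : ℕ} (h : i < n) :
    ((List.range n).map f).getD i d = f i := by
  simp [List.getD, h]

open Primrec in
-- Course-of-values recursion on the code: subterms have smaller codes, so their values can be
-- looked up in the list of earlier results.
theorem Term.primrec_eval {v : α → ℕ → ℕ} (hv : Primrec₂ v) :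
    Primrec₂ fun a (t : Term) => t.eval (v a) := by
  -- The list `l` holds the values of all terms with smaller codes, so its length is the current
  -- code. Code `0` is the term `zero`; from a positive code, one is subtracted before splitting off
  -- the constructor modulo `3`.
  let third (l : List ℕ) : ℕ := (l.length - 1) / 3
  let g (a : α) (l : List ℕ) : ℕ :=
    if l.length = 0 then 0
    else if (l.length - 1) % 3 = 0 then v a (third l)
    else if (l.length - 1) % 3 = 1 then l.getD (third l) 0 + 1
    else if l.getD (third l).unpair.1.unpair.1 0 = l.getD (third l).unpair.1.unpair.2 0
      then l.getD (third l).unpair.2.unpair.1 0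
      else l.getD (third l).unpair.2.unpair.2 0
  have hlen : Primrec fun p : α × List ℕ => p.2.length := list_length.comp snd
  have hpre : Primrec fun p : α × List ℕ => p.2.length - 1 := nat_sub.comp hlen (const 1)
  have hthird : Primrec fun p : α × List ℕ => third p.2 := nat_div.comp hpre (const 3)
  have hmod : Primrec fun p : α × List ℕ => (p.2.length - 1) % 3 := nat_mod.comp hpre (const 3)
  have hu := Primrec.unpair.comp hthird
  have hu1 := Primrec.unpair.comp (fst.comp hu)
  have hu2 := Primrec.unpair.comp (snd.comp hu)
  have hget {f : α × List ℕ → ℕ} (hf : Primrec f) :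
      Primrec fun p : α × List ℕ => p.2.getD (f p) 0 := (list_getD 0).comp snd hf
  have hg : Primrec₂ g :=
    ite (Primrec.eq.comp hlen (const 0)) (const 0) <|
    ite (Primrec.eq.comp hmod (const 0)) (hv.comp fst hthird) <|
    ite (Primrec.eq.comp hmod (const 1)) (Primrec.succ.comp (hget hthird)) <|
    ite (Primrec.eq.comp (hget (fst.comp hu1)) (hget (snd.comp hu1)))
      (hget (fst.comp hu2)) (hget (snd.comp hu2))
  have main : Primrec₂ fun a n => (Term.ofNat n).eval (v a) := by
    refine nat_strong_rec _ (option_some.comp₂ hg) ?_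
    intro a n
    congr 1
    cases n with
    | zero => simp [g, ofNat, eval]
    | succ n =>
      have hm : n / 3 < n + 1 := Nat.lt_succ_of_le (Nat.div_le_self n 3)
      have h1 := lt_of_le_of_lt
        ((Nat.unpair_left_le _).trans (Nat.unpair_left_le (n / 3))) hm
      have h2 := lt_of_le_of_lt
        ((Nat.unpair_right_le _).trans (Nat.unpair_left_le (n / 3))) hm
      have h3 := lt_of_le_of_lt
        ((Nat.unpair_left_le _).trans (Nat.unpair_right_le (n / 3))) hm
      have h4 := lt_of_le_of_lt
        ((Nat.unpair_right_le _).trans (Nat.unpair_right_le (n / 3))) hm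
      simp only [g, third, List.length_map, List.length_range, Nat.add_sub_cancel]
      rw [getD_map_range _ _ hm, getD_map_range _ _ h1, getD_map_range _ _ h2,
        getD_map_range _ _ h3, getD_map_range _ _ h4, ofNat, if_neg (Nat.succ_ne_zero n)]
      have hlt : n % 3 < 3 := Nat.mod_lt _ (by norm_num)
      rcases hk : n % 3 with _ | _ | k
      · simp [eval]
      · simp [eval]
      · simp [eval]
  exact (main.comp₂ Primrec₂.left (Primrec.encode.comp snd).to₂).of_eq fun a t => by
    rw [encode_eq, ofNat_toNat]

open Primrec Classical in
theorem Formula.primrec_holds {v : α → ℕ → ℕ} (hv : Primrec₂ v) :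
    PrimrecRel fun a (φ : Formula) => φ.Holds (v a) := by
  -- The same recursion with truth values. Here code `0` is an ordinary equation, so no shift is
  -- needed.
  let third (l : List Bool) : ℕ := l.length / 3
  let g (a : α) (l : List Bool) : Bool :=
    if l.length % 3 = 0 then
      decide ((Term.ofNat (third l).unpair.1).eval (v a) =
        (Term.ofNat (third l).unpair.2).eval (v a))
    else if l.length % 3 = 1 then !(l.getD (third l) false)
    else l.getD (third l).unpair.1 false && l.getD (third l).unpair.2 false
  have hlen : Primrec fun p : α × List Bool => p.2.length := list_length.comp snd
  have hthird : Primrec fun p : α × List Bool => third p.2 := nat_div.comp hlen (const 3)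
  have hmod : Primrec fun p : α × List Bool => p.2.length % 3 := nat_mod.comp hlen (const 3)
  have hu := Primrec.unpair.comp hthird
  have hget {f : α × List Bool → ℕ} (hf : Primrec f) :
      Primrec fun p : α × List Bool => p.2.getD (f p) false := (list_getD false).comp snd hf
  have hterm {f : α × List Bool → ℕ} (hf : Primrec f) :
      Primrec fun p : α × List Bool => (Term.ofNat (f p)).eval (v p.1) :=
    (Term.primrec_eval hv).comp fst ((Primrec.ofNat Term).comp hf)
  have hg : Primrec₂ g :=
    ite (Primrec.eq.comp hmod (const 0))
      (Primrec.eq.comp (hterm (fst.comp hu)) (hterm (snd.comp hu))).decide <|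
    ite (Primrec.eq.comp hmod (const 1)) (Primrec.not.comp (hget hthird)) <|
    Primrec.and.comp (hget (fst.comp hu)) (hget (snd.comp hu))
  have main : Primrec₂ fun a n => decide ((Formula.ofNat n).Holds (v a)) := by
    refine nat_strong_rec _ (option_some.comp₂ hg) ?_
    intro a n
    congr 1
    obtain ⟨φ, rfl⟩ : ∃ φ : Formula, n = φ.toNat := ⟨ofNat n, (toNat_ofNat n).symm⟩
    simp only [g, third, List.length_map, List.length_range, ofNat_toNat]
    cases φ with
    | eq s t =>
      have e : 3 * Nat.pair s.toNat t.toNat / 3 = Nat.pair s.toNat t.toNat := by omega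
      refine Bool.eq_iff_iff.2 (Iff.trans ?_ decide_eq_true_iff.symm)
      simp [toNat, e, Holds, Term.ofNat_toNat]
    | neg φ =>
      have e : (3 * φ.toNat + 1) / 3 = φ.toNat := by omega
      have e' : (3 * φ.toNat + 1) % 3 = 1 := by omega
      simp only [toNat, e, e']
      rw [getD_map_range _ _ (by omega)]
      refine Bool.eq_iff_iff.2 (Iff.trans ?_ decide_eq_true_iff.symm)
      simp [Holds, ofNat_toNat]
    | and φ ψ =>
      have e : (3 * Nat.pair φ.toNat ψ.toNat + 2) / 3 = Nat.pair φ.toNat ψ.toNat := by omega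
      have e' : (3 * Nat.pair φ.toNat ψ.toNat + 2) % 3 = 2 := by omega
      have l1 := Nat.left_le_pair φ.toNat ψ.toNat
      have l2 := Nat.right_le_pair φ.toNat ψ.toNat
      simp only [toNat, e, e', Nat.unpair_pair]
      rw [getD_map_range _ _ (show φ.toNat < _ by omega),
        getD_map_range _ _ (show ψ.toNat < _ by omega)]
      refine Bool.eq_iff_iff.2 (Iff.trans ?_ decide_eq_true_iff.symm)
      simp [Holds, ofNat_toNat]
  refine Primrec.primrecPred ((main.comp fst (Primrec.encode.comp snd)).of_eq fun p => ?_)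
  rw [encode_eq, ofNat_toNat]

open Primrec in
theorem primrec_nat_pow : Primrec₂ ((· ^ ·) : ℕ → ℕ → ℕ) :=
  Primrec₂.unpaired'.1 Nat.Primrec.pow

open Primrec in
theorem Formula.computablePred_isSat : ComputablePred fun p : Formula × ℕ => p.1.IsSat p.2 := by
  have hN {β : Type} [Primcodable β] {f : β → ℕ} (hf : Primrec f) :
      Primrec fun b => 3 * (f b + 1) := nat_mul.comp (const 3) (succ.comp hf)
  have hbase : Primrec fun p : Formula × ℕ => p.1.base p.2 :=
    succ.comp (nat_mul.comp (succ.comp (hN snd)) (succ.comp (Primrec.encode.comp fst)))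
  have hdig : Primrec₂ fun (q : ℕ × Formula × ℕ) n =>
      digitValuation (q.2.1.base q.2.2) (3 * (q.2.2 + 1)) q.1 n := by
    have hb : Primrec fun p : (ℕ × Formula × ℕ) × ℕ => p.1.2.1.base p.1.2.2 :=
      hbase.comp (snd.comp fst)
    exact ite (nat_lt.comp snd (hN (snd.comp (snd.comp fst))))
      (nat_mod.comp (nat_div.comp (fst.comp fst) (primrec_nat_pow.comp hb snd)) hb) (const 0)
  have hrel : PrimrecRel fun (w : ℕ) (p : Formula × ℕ) =>
      p.1.Holds (digitValuation (p.1.base p.2) (3 * (p.2 + 1)) w) :=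
    (Formula.primrec_holds hdig).comp Primrec.id (fst.comp snd)
  refine PrimrecPred.computablePred ?_
  refine (hrel.exists_mem_list.comp
    (list_range.comp (primrec_nat_pow.comp hbase (hN snd))) Primrec.id).of_eq fun p => ?_
  rw [isSat_iff_exists_digits]
  simp

end Eval

/-! ### Reduction of halting to opacity -/

namespace Term

/-- The closed term with value `n`. -/
def numeral : ℕ → Term
  | 0 => zero
  | n + 1 => succ (numeral n)

theorem eval_numeral (v : ℕ → ℕ) (n : ℕ) : (numeral n).eval v = n := by
  induction n with
  | zero => rfl
  | succ n ih => simp [numeral, eval, ih]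

end Term

/-- The formula that relates a configuration `(v₀, v₁, v₂)` to its successor `(v₃, v₄, v₅)` under an
instruction. -/
def CMInstr.execFormula : CMInstr → Formula
  | .inc j => .and (.eq (.var (3 + j)) (.succ (.var j)))
      (.and (.eq (.var (3 + j.rev)) (.var j.rev)) (.eq (.var 5) (.succ (.var 2))))
  | .dec j => .and (.eq (.succ (.var (3 + j))) (.var j))
      (.and (.eq (.var (3 + j.rev)) (.var j.rev)) (.eq (.var 5) (.succ (.var 2))))
  | .jz j z => .and (.eq (.var 3) (.var 0)) (.and (.eq (.var 4) (.var 1))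
      (.eq (.var 5) (.ifEq (.var j) .zero (.numeral z) (.succ (.var 2)))))
  | .jmp z => .and (.eq (.var 3) (.var 0)) (.and (.eq (.var 4) (.var 1))
      (.eq (.var 5) (.numeral z)))

theorem CMInstr.holds_execFormula (ι : CMInstr) (b : Triple) (a : Fin 1 → Triple) :
    ι.execFormula.Holds (valuation b a) ↔ CMProgram.Exec b (a 0) ι := by
  have h0 : valuation b a 0 = b 0 := rfl
  have h1 : valuation b a 1 = b 1 := rfl
  have h2 : valuation b a 2 = b 2 := rfl
  have h3 : valuation b a 3 = a 0 0 := rfl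
  have h4 : valuation b a 4 = a 0 1 := rfl
  have h5 : valuation b a 5 = a 0 2 := rfl
  cases ι with
  | inc j =>
    fin_cases j <;> simp [execFormula, Formula.Holds, Term.eval, CMProgram.Exec,
      h0, h1, h2, h3, h4, h5]
  | dec j =>
    fin_cases j <;> simp [execFormula, Formula.Holds, Term.eval, CMProgram.Exec,
      h0, h1, h2, h3, h4, h5]
  | jz j z =>
    fin_cases j <;> simp [execFormula, Formula.Holds, Term.eval, CMProgram.Exec, Term.eval_numeral,
      h0, h1, h2, h3, h4, h5]
  | jmp z =>
    simp [execFormula, Formula.Holds, Term.eval, CMProgram.Exec, Term.eval_numeral,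
      h0, h1, h3, h4, h5]

/-- The formula stating that `v₂` is not one of `1, …, n`. -/
def outsideFormula : ℕ → Formula
  | 0 => .eq .zero .zero
  | n + 1 => .and (.neg (.eq (.var 2) (.numeral (n + 1)))) (outsideFormula n)

theorem holds_outsideFormula (n : ℕ) (v : ℕ → ℕ) :
    (outsideFormula n).Holds v ↔ v 2 = 0 ∨ n < v 2 := by
  induction n with
  | zero =>
    simp only [outsideFormula, Formula.Holds, true_iff]
    omega
  | succ n ih =>
    simp only [outsideFormula, Formula.Holds, ih, Term.eval, Term.eval_numeral]
    omega

namespace CMProgram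

/-- The selfloop at `q₀` that executes the instruction `ι` with number `i + 1`; the event parameter
guesses the next configuration. -/
def instrTransition (i : ℕ) (ι : CMInstr) : TransitionCode 4 4 where
  src := 0
  tgt := 0
  k := 1
  tag := 0
  guard := .and (.eq (.var 2) (.numeral (i + 1))) ι.execFormula
  upd := ![.var 3, .var 4, .var 5]

/-- The transition from `q₀` to `q₃` for configurations that have halted in a program of length `n`. -/
def haltTransition (n : ℕ) : TransitionCode 4 4 where
  src := 0
  tgt := 3
  k := 1
  tag := 0
  guard := outsideFormula n
  upd := ![.var 0, .var 1, .var 2]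

/-- The automaton that runs the program `P` at `q₀` and moves to `q₃` once `P` has halted. -/
def toInstance (P : CMProgram) : OpacityInstance 4 4 where
  init := [0]
  marked := [3]
  initParam := .and (.eq (.var 0) .zero) (.and (.eq (.var 1) .zero) (.eq (.var 2) (.numeral 1)))
  trans := haltTransition P.length ::
    -- The default `.jmp 0` is never read, since `i` stays below the length.
    (List.range P.length).map fun i => instrTransition i (P.getD i (.jmp 0))
  secret := [0, 1, 2]
  nonSecret := [3]
  observable := .neg (.eq .zero .zero)

variable (P : CMProgram)

theorem observable_toInstance : P.toInstance.observable.den = ∅ := by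
  ext b
  simp [toInstance, Formula.den, Formula.Holds]

theorem isSimple_toInstance : P.toInstance.IsSimple := by
  refine ⟨?_, ?_, ?_, ?_, P.observable_toInstance⟩
  · intro t ht
    simp only [toInstance, List.mem_cons, List.mem_map] at ht
    rcases ht with rfl | ⟨i, -, rfl⟩ <;> rfl
  · ext q
    simp [toInstance]
  · ext q
    simp [toInstance]
  · ext q
    simp [toInstance]

theorem mem_initParam_toInstance (b : Triple) :
    b ∈ P.toInstance.toEFA.initParam ↔ b = ![0, 0, 1] := by
  have h0 : valuation b Fin.elim0 0 = b 0 := rfl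
  have h1 : valuation b Fin.elim0 1 = b 1 := rfl
  have h2 : valuation b Fin.elim0 2 = b 2 := rfl
  simp [OpacityInstance.toEFA, toInstance, Formula.den, Formula.Holds, Term.eval,
    Term.eval_numeral, h0, h1, h2, funext_iff, Fin.forall_fin_succ]

theorem instrAt_eq_none_iff (i : ℕ) : P.instrAt i = none ↔ i = 0 ∨ P.length < i := by
  unfold instrAt
  split_ifs with h
  · simp [h]
  · rw [List.getElem?_eq_none_iff]
    omega

theorem instrAt_succ (i : ℕ) : P.instrAt (i + 1) = P[i]? := by simp [instrAt]

theorem evalUpd_instrTransition (i : ℕ) (ι : CMInstr) (b : Triple) (a : Fin 1 → Triple) :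
    (instrTransition i ι).toSym.upd b a = a 0 := by
  funext j
  fin_cases j <;> rfl

theorem evalUpd_haltTransition (n : ℕ) (b : Triple) (a : Fin 1 → Triple) :
    (haltTransition n).toSym.upd b a = b := by
  funext j
  fin_cases j <;> rfl

variable {P}

/-- The first conjunct of a loop guard pins the program counter to `i + 1`, so only the loop of the
current instruction can fire, and its update copies the guess that the guard has verified. -/
theorem step_of_step_toEFA {p p' : Fin 4 × Triple} {v : ParamEvent (Fin 4) Triple}
    (h : P.toInstance.toEFA.Step p v p') :
    p.1 = 0 ∧ ((p'.1 = 0 ∧ P.Step p.2 p'.2) ∨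
      (p'.1 = 3 ∧ p'.2 = p.2 ∧ P.instrAt (p.2 2) = none)) := by
  obtain ⟨r, hr, a, hsrc, htgt, -, hguard, hupd⟩ := h
  simp only [OpacityInstance.toEFA, toInstance, Set.mem_image, Set.mem_ofPred_eq, List.mem_cons,
    List.mem_map, List.mem_range] at hr
  obtain ⟨t, rfl | ⟨i, hi, rfl⟩, rfl⟩ := hr
  · refine ⟨hsrc, Or.inr ⟨htgt, hupd.trans (evalUpd_haltTransition _ _ _), ?_⟩⟩
    rw [instrAt_eq_none_iff]
    exact (holds_outsideFormula P.length (valuation p.2 a)).1 hguard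
  · refine ⟨hsrc, Or.inl ⟨htgt, ?_⟩⟩
    have hg : p.2 2 = i + 1 ∧ (P.getD i (.jmp 0)).execFormula.Holds (valuation p.2 a) := by
      have : valuation p.2 a 2 = (Term.numeral (i + 1)).eval (valuation p.2 a) ∧ _ := hguard
      rwa [Term.eval_numeral] at this
    have hupd' : p'.2 = a (0 : Fin 1) := hupd.trans (evalUpd_instrTransition i _ p.2 a)
    rw [hupd']
    refine ⟨P.getD i (.jmp 0), ?_, (CMInstr.holds_execFormula _ _ _).1 hg.2⟩
    rw [hg.1, instrAt_succ]
    simp [List.getD, hi]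

theorem exists_step_toEFA_of_step {b b' : Triple} (h : P.Step b b') :
    ∃ v, P.toInstance.toEFA.Step (0, b) v (0, b') := by
  obtain ⟨ι, hι, hex⟩ := h
  obtain ⟨i, hi⟩ : ∃ i, b 2 = i + 1 := by
    refine Nat.exists_eq_succ_of_ne_zero fun h0 => ?_
    simp [h0, instrAt] at hι
  rw [hi, instrAt_succ] at hι
  obtain ⟨hlt, -⟩ := List.getElem?_eq_some_iff.1 hι
  have hget : P.getD i (.jmp 0) = ι := by simp [List.getD, hι]
  refine ⟨(0, [b']), (instrTransition i ι).toSym, ⟨_, ?_, rfl⟩, fun _ : Fin 1 => b', rfl, rfl, ?_,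
    ?_, ?_⟩
  · simp only [toInstance, Set.mem_ofPred_eq, List.mem_cons, List.mem_map, List.mem_range]
    exact Or.inr ⟨i, hlt, by rw [hget]⟩
  · rfl
  · exact ⟨hi.trans (Term.eval_numeral _ _).symm, (CMInstr.holds_execFormula ι b _).2 hex⟩
  · exact (evalUpd_instrTransition i ι b fun _ => b').symm

theorem exists_step_toEFA_of_halted {b : Triple} (h : P.instrAt (b 2) = none) :
    ∃ v, P.toInstance.toEFA.Step (0, b) v (3, b) := by
  refine ⟨(0, [b]), (haltTransition P.length).toSym, ⟨_, ?_, rfl⟩, fun _ : Fin 1 => b, rfl, rfl,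
    rfl, ?_, ?_⟩
  · simp [toInstance]
  · exact (holds_outsideFormula _ _).2 ((P.instrAt_eq_none_iff _).1 h)
  · exact (evalUpd_haltTransition _ _ _).symm

/-- A path to `q₃` consists of machine steps at `q₀` up to the halting edge, whose guard certifies
that the configuration has halted. -/
theorem reaches_of_path {p p' : Fin 4 × Triple} {u : List (ParamEvent (Fin 4) Triple)}
    (h : P.toInstance.toEFA.Path p u p') (h0 : p.1 = 0) (h3 : p'.1 = 3) :
    ∃ x, Relation.ReflTransGen P.Step p.2 x ∧ P.instrAt (x 2) = none := by
  induction h with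
  | nil p => simp [h0] at h3
  | cons hs hp ih =>
    obtain ⟨-, ⟨h0', hstep⟩ | ⟨-, -, hnone⟩⟩ := step_of_step_toEFA hs
    · obtain ⟨x, hx, hn⟩ := ih h0' h3
      exact ⟨x, hx.head hstep, hn⟩
    · exact ⟨_, .refl, hnone⟩

theorem exists_path_of_reaches {b x : Triple} (h : Relation.ReflTransGen P.Step b x)
    (hx : P.instrAt (x 2) = none) : ∃ u, P.toInstance.toEFA.Path (0, b) u (3, x) := by
  induction h using Relation.ReflTransGen.head_induction_on with
  | refl =>
    obtain ⟨v, hv⟩ := exists_step_toEFA_of_halted hx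
    exact ⟨[v], .cons hv (.nil _)⟩
  | head hs _ ih =>
    obtain ⟨u, hu⟩ := ih
    obtain ⟨v, hv⟩ := exists_step_toEFA_of_step hs
    exact ⟨v :: u, .cons hv hu⟩

theorem halts_iff_reachable : P.Halts ↔ P.toInstance.toEFA.Reachable 3 := by
  have hinit : (0 : Fin 4) ∈ P.toInstance.toEFA.init := by
    simp [OpacityInstance.toEFA, toInstance]
  constructor
  · rintro ⟨x, hx, hn⟩
    obtain ⟨u, hu⟩ := exists_path_of_reaches hx hn
    exact ⟨u, 0, hinit, 3, rfl, _, _, hu, fun _ => (P.mem_initParam_toInstance _).2 rfl⟩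
  · rintro ⟨u, q₁, hq₁, q₂, rfl, b₁, b₂, hu, hb⟩
    have h1 : q₁ = 0 := by
      simpa [OpacityInstance.toEFA, toInstance] using hq₁
    obtain ⟨x, hx, hn⟩ := reaches_of_path hu h1 rfl
    refine ⟨x, ?_, hn⟩
    have hb' := (P.mem_initParam_toInstance _).1 (hb hq₁)
    simp only [hb'] at hx
    exact hx

end CMProgram

theorem EFA.observe_empty {X : Type} (d : List (List X)) : EFA.observe ∅ d = [] := by
  simp [EFA.observe]

namespace CMProgram

variable {P : CMProgram}

/-- With all observations empty, one string to `q₃` matches every secret string. Conversely the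
empty string is secret, since `q₀` is both initial and secret, so it needs a match. -/
theorem reachable_iff_opaque : P.toInstance.toEFA.Reachable 3 ↔ P.toInstance.Opaque := by
  have hns : {q | q ∈ P.toInstance.nonSecret} = ({3} : Set (Fin 4)) := (isSimple_toInstance P).2.2.2.1
  unfold OpacityInstance.Opaque EFA.CurrentStateOpaque EFA.Reachable
  rw [hns, observable_toInstance]
  constructor
  · rintro ⟨v, hv⟩ u -
    exact ⟨v, hv, by rw [EFA.observe_empty, EFA.observe_empty]⟩
  · intro h
    obtain ⟨v, hv, -⟩ := h []
      ⟨0, by simp [OpacityInstance.toEFA, toInstance], 0, by simp [toInstance], ![0, 0, 1],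
        ![0, 0, 1], .nil _, fun _ => (P.mem_initParam_toInstance _).2 rfl⟩
    exact ⟨v, hv⟩

end CMProgram

/-! ### Computability of the reduction -/

section Computability

variable {α : Type} [Primcodable α]

open Primrec

/-- Since encoding is `toNat`, each constructor acts on codes by pairing and linear arithmetic; the
constants here and below are those of `toNat`. -/
theorem Term.primrec_succ {f : α → Term} (hf : Primrec f) : Primrec fun a => (f a).succ :=
  Primrec.encode_iff.1 <|
    nat_add.comp (nat_mul.comp (const 3) (Primrec.encode_iff.2 hf)) (const 2)

theorem Term.primrec_ifEq {s t f g : α → Term} (hs : Primrec s) (ht : Primrec t) (hf : Primrec f)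
    (hg : Primrec g) : Primrec fun a => Term.ifEq (s a) (t a) (f a) (g a) :=
  Primrec.encode_iff.1 <| nat_add.comp (nat_mul.comp (const 3) <| Primrec₂.natPair.comp
    (Primrec₂.natPair.comp (Primrec.encode_iff.2 hs) (Primrec.encode_iff.2 ht))
    (Primrec₂.natPair.comp (Primrec.encode_iff.2 hf) (Primrec.encode_iff.2 hg))) (const 3)

theorem Term.primrec_numeral : Primrec Term.numeral :=
  (nat_rec₁ Term.zero (f := fun _ t => t.succ) (Term.primrec_succ snd).to₂).of_eq fun n => by
    induction n with
    | zero => rfl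
    | succ n ih => rw [numeral, ← ih]

theorem Formula.primrec_eq {s t : α → Term} (hs : Primrec s) (ht : Primrec t) :
    Primrec fun a => Formula.eq (s a) (t a) :=
  Primrec.encode_iff.1 <| nat_mul.comp (const 3) <|
    Primrec₂.natPair.comp (Primrec.encode_iff.2 hs) (Primrec.encode_iff.2 ht)

theorem Formula.primrec_neg {f : α → Formula} (hf : Primrec f) : Primrec fun a => (f a).neg :=
  Primrec.encode_iff.1 <|
    nat_add.comp (nat_mul.comp (const 3) (Primrec.encode_iff.2 hf)) (const 1)

theorem Formula.primrec_and {f g : α → Formula} (hf : Primrec f) (hg : Primrec g) :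
    Primrec fun a => (f a).and (g a) :=
  Primrec.encode_iff.1 <| nat_add.comp (nat_mul.comp (const 3) <|
    Primrec₂.natPair.comp (Primrec.encode_iff.2 hf) (Primrec.encode_iff.2 hg)) (const 2)

theorem primrec_outsideFormula : Primrec outsideFormula :=
  (nat_rec₁ (Formula.eq .zero .zero)
    (f := fun n φ => .and (.neg (.eq (.var 2) (.numeral (n + 1)))) φ)
    (Formula.primrec_and (Formula.primrec_neg (Formula.primrec_eq (const _)
      (Term.primrec_numeral.comp (Primrec.succ.comp fst)))) snd).to₂).of_eq fun n => by
    induction n with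
    | zero => rfl
    | succ n ih => rw [outsideFormula, ← ih]

theorem CMInstr.primrec_execFormula : Primrec CMInstr.execFormula := by
  have hjz : Primrec fun p : Fin 2 × ℕ => (CMInstr.jz p.1 p.2).execFormula :=
    Formula.primrec_and (const _) <| Formula.primrec_and (const _) <|
      Formula.primrec_eq (const _) <| Term.primrec_ifEq
        ((dom_finite fun j : Fin 2 => Term.var j).comp fst) (const _)
        (Term.primrec_numeral.comp snd) (const _)
  have hjmp : Primrec fun z : ℕ => (CMInstr.jmp z).execFormula :=
    Formula.primrec_and (const _) <| Formula.primrec_and (const _) <|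
      Formula.primrec_eq (const _) Term.primrec_numeral
  have hsum : Primrec fun s : Fin 2 ⊕ Fin 2 ⊕ (Fin 2 × ℕ) ⊕ ℕ =>
      (CMInstr.equivSum.symm s).execFormula :=
    (sumCasesOn Primrec.id ((dom_finite fun j => (CMInstr.inc j).execFormula).comp snd).to₂
      (sumCasesOn snd ((dom_finite fun j => (CMInstr.dec j).execFormula).comp snd).to₂
        (sumCasesOn snd (hjz.comp snd).to₂ (hjmp.comp snd).to₂).to₂).to₂).of_eq fun s => by
      rcases s with j | j | ⟨j, z⟩ | z <;> rfl
  exact (hsum.comp (Primrec.of_equiv (e := CMInstr.equivSum))).of_eq fun ι => by simp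

theorem CMProgram.primrec_instrTransition : Primrec₂ CMProgram.instrTransition := by
  have h : Primrec fun p : ℕ × CMInstr =>
      ((0, 0, 1, 0, .and (.eq (.var 2) (.numeral (p.1 + 1))) p.2.execFormula,
        ![.var 3, .var 4, .var 5]) :
          Fin 4 × Fin 4 × ℕ × Fin 4 × Formula × (Fin 3 → Term)) :=
    (const _).pair <| (const _).pair <| (const _).pair <| (const _).pair <|
      (Formula.primrec_and (Formula.primrec_eq (const _)
        (Term.primrec_numeral.comp (Primrec.succ.comp fst)))
        (CMInstr.primrec_execFormula.comp snd)).pair (const _)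
  exact (Primrec.of_equiv_symm (e := TransitionCode.equivProd)).comp h

theorem CMProgram.primrec_haltTransition : Primrec CMProgram.haltTransition := by
  have h : Primrec fun n : ℕ =>
      ((0, 3, 1, 0, outsideFormula n, ![.var 0, .var 1, .var 2]) :
          Fin 4 × Fin 4 × ℕ × Fin 4 × Formula × (Fin 3 → Term)) :=
    (const _).pair <| (const _).pair <| (const _).pair <| (const _).pair <|
      primrec_outsideFormula.pair (const _)
  exact (Primrec.of_equiv_symm (e := TransitionCode.equivProd)).comp h

theorem CMProgram.primrec_toInstance : Primrec CMProgram.toInstance := by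
  have htrans : Primrec fun P : CMProgram => haltTransition P.length ::
      (List.range P.length).map fun i => instrTransition i (P.getD i (.jmp 0)) :=
    list_cons.comp (primrec_haltTransition.comp list_length) <|
      list_map (list_range.comp list_length) <|
        (primrec_instrTransition.comp snd ((list_getD (.jmp 0)).comp fst snd)).to₂
  have h : Primrec fun P : CMProgram => OpacityInstance.equivProd P.toInstance :=
    (const _).pair <| (const _).pair <| (const _).pair <| htrans.pair <| (const _).pair <|
      (const _).pair (const _)
  exact ((Primrec.of_equiv_symm (e := OpacityInstance.equivProd)).comp h).of_eq fun P => by simp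

end Computability

/-! ### Code fragments of two-counter machines -/

namespace CMProgram

/-- The fragment `C` occurs in the program at address `s`. -/
def CodeAt (P : CMProgram) (s : ℕ) (C : List CMInstr) : Prop :=
  ∀ i ι, C[i]? = some ι → P.instrAt (s + i) = some ι

/-- Finitely many computation steps. -/
abbrev Reaches (P : CMProgram) : Triple → Triple → Prop := Relation.ReflTransGen P.Step

/-- The configuration in which register `j` contains `a`, the other register `b`, and the program
counter is `c`. -/
def config (j : Fin 2) (a b c : ℕ) : Triple := if j = 0 then ![a, b, c] else ![b, a, c]

theorem config_zero (a b c : ℕ) : config 0 a b c = ![a, b, c] := rfl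

theorem config_one (a b c : ℕ) : config 1 a b c = ![b, a, c] := rfl

theorem config_two (j : Fin 2) (a b c : ℕ) : config j a b c 2 = c := by
  fin_cases j <;> rfl

variable {P : CMProgram}

theorem codeAt_cons {s : ℕ} {ι : CMInstr} {C : List CMInstr} :
    P.CodeAt s (ι :: C) ↔ P.instrAt s = some ι ∧ P.CodeAt (s + 1) C := by
  constructor
  · intro h
    refine ⟨h 0 ι rfl, fun i κ hi => ?_⟩
    rw [add_assoc, add_comm 1]
    exact h (i + 1) κ (by simpa using hi)
  · rintro ⟨h0, h⟩ i κ hi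
    cases i with
    | zero => simp_all
    | succ i =>
      rw [add_comm i, ← add_assoc]
      exact h i κ (by simpa using hi)

theorem CodeAt.left {s : ℕ} {C D : List CMInstr} (h : P.CodeAt s (C ++ D)) : P.CodeAt s C := by
  intro i ι hi
  refine h i ι ?_
  rw [List.getElem?_append_left (List.getElem?_eq_some_iff.1 hi).1]
  exact hi

theorem CodeAt.right {s t : ℕ} {C D : List CMInstr} (h : P.CodeAt s (C ++ D))
    (ht : t = s + C.length) : P.CodeAt t D := by
  subst ht
  intro i ι hi
  rw [add_assoc]
  refine h _ ι ?_
  rw [List.getElem?_append_right (by omega), Nat.add_sub_cancel_left]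
  exact hi

theorem CodeAt.single {s : ℕ} {ι : CMInstr} (h : P.CodeAt s [ι]) : P.instrAt s = some ι :=
  (codeAt_cons.1 h).1

theorem step_inc {j : Fin 2} {c : ℕ} (h : P.instrAt c = some (.inc j)) (a b : ℕ) :
    P.Step (config j a b c) (config j (a + 1) b (c + 1)) := by
  refine ⟨.inc j, by rwa [config_two], ?_⟩
  fin_cases j <;> exact ⟨rfl, rfl, rfl⟩

theorem step_inc_rev {j : Fin 2} {c : ℕ} (h : P.instrAt c = some (.inc j.rev)) (a b : ℕ) :
    P.Step (config j a b c) (config j a (b + 1) (c + 1)) := by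
  refine ⟨.inc j.rev, by rwa [config_two], ?_⟩
  fin_cases j <;> exact ⟨rfl, rfl, rfl⟩

theorem step_dec {j : Fin 2} {c : ℕ} (h : P.instrAt c = some (.dec j)) (a b : ℕ) :
    P.Step (config j (a + 1) b c) (config j a b (c + 1)) := by
  refine ⟨.dec j, by rwa [config_two], ?_⟩
  fin_cases j <;> exact ⟨rfl, rfl, rfl⟩

theorem step_jz_zero {j : Fin 2} {c z : ℕ} (h : P.instrAt c = some (.jz j z)) (b : ℕ) :
    P.Step (config j 0 b c) (config j 0 b z) := by
  refine ⟨.jz j z, by rwa [config_two], ?_⟩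
  fin_cases j <;> exact ⟨rfl, rfl, rfl⟩

theorem step_jz_succ {j : Fin 2} {c z : ℕ} (h : P.instrAt c = some (.jz j z)) (a b : ℕ) :
    P.Step (config j (a + 1) b c) (config j (a + 1) b (c + 1)) := by
  refine ⟨.jz j z, by rwa [config_two], ?_⟩
  fin_cases j <;> exact ⟨rfl, rfl, rfl⟩

theorem step_jmp {c z : ℕ} (h : P.instrAt c = some (.jmp z)) (j : Fin 2) (a b : ℕ) :
    P.Step (config j a b c) (config j a b z) := by
  refine ⟨.jmp z, by rwa [config_two], ?_⟩
  fin_cases j <;> exact ⟨rfl, rfl, rfl⟩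

theorem reaches_inc {j : Fin 2} {s p : ℕ} (h : ∀ i < p, P.instrAt (s + i) = some (.inc j))
    (a b : ℕ) : P.Reaches (config j a b s) (config j (a + p) b (s + p)) := by
  induction p with
  | zero => exact .refl
  | succ p ih => exact (ih fun i hi => h i (by omega)).tail (step_inc (h p (by omega)) _ _)

theorem reaches_inc_rev {j : Fin 2} {s p : ℕ} (h : ∀ i < p, P.instrAt (s + i) = some (.inc j.rev))
    (a b : ℕ) : P.Reaches (config j a b s) (config j a (b + p) (s + p)) := by
  induction p with
  | zero => exact .refl
  | succ p ih => exact (ih fun i hi => h i (by omega)).tail (step_inc_rev (h p (by omega)) _ _)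

theorem CodeAt.replicate {s p : ℕ} {ι : CMInstr} (h : P.CodeAt s (List.replicate p ι)) (i : ℕ)
    (hi : i < p) : P.instrAt (s + i) = some ι :=
  h i ι (by simp [hi])

/-- Empties register `j`, and adds `p` times its contents to the other register. -/
def transferCode (j : Fin 2) (p s : ℕ) : List CMInstr :=
  .jz j (s + p + 3) :: .dec j :: (List.replicate p (.inc j.rev) ++ [.jmp s])

theorem length_transferCode (j : Fin 2) (p s : ℕ) : (transferCode j p s).length = p + 3 := by
  simp [transferCode]

/-- Each round of the loop trades one unit of register `j` for `p` units of the other. -/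
theorem reaches_transfer {j : Fin 2} {p s : ℕ} (h : P.CodeAt s (transferCode j p s)) (a b : ℕ) :
    P.Reaches (config j a b s) (config j 0 (b + p * a) (s + p + 3)) := by
  obtain ⟨h1, h⟩ := codeAt_cons.1 h
  obtain ⟨h2, h⟩ := codeAt_cons.1 h
  have h3 := h.left.replicate
  have h4 := (h.right (t := s + p + 2) (by simp; omega)).single
  induction a generalizing b with
  | zero => exact .single (step_jz_zero h1 b)
  | succ a ih =>
    have e1 := ((Relation.ReflTransGen.single (step_jz_succ h1 a b)).tail (step_dec h2 a b)).trans
      (reaches_inc_rev h3 a b)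
    have e2 : s + 1 + 1 + p = s + p + 2 := by omega
    rw [e2] at e1
    have e3 : b + p * (a + 1) = b + p + p * a := by ring
    rw [e3]
    exact (e1.tail (step_jmp h4 _ _ _)).trans (ih _)

/-- Multiplies the first register by `p`, when the second is zero. -/
def mulCode (p s : ℕ) : List CMInstr := transferCode 0 p s ++ transferCode 1 1 (s + p + 3)

theorem length_mulCode (p s : ℕ) : (mulCode p s).length = p + 7 := by
  simp [mulCode, length_transferCode]

/-- Transfer with factor `p`, then back with factor `1`. -/
theorem reaches_mul {p s : ℕ} (h : P.CodeAt s (mulCode p s)) (a : ℕ) :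
    P.Reaches ![a, 0, s] ![a * p, 0, s + (p + 7)] := by
  have e1 := reaches_transfer h.left a 0
  have e2 := reaches_transfer (h.right (by simp [length_transferCode]; omega)) (p * a) 0
  simp only [config_zero, config_one] at e1 e2
  have h1 : a * p = 0 + 1 * (p * a) := by ring
  have h2 : s + (p + 7) = s + p + 3 + 1 + 3 := by ring
  rw [h1, h2]
  rw [zero_add] at e1
  exact e1.trans e2

/-- Repeatedly subtracts `p` from the first register and counts in the second; jumps to `R r` when
the remainder is `r`. -/
def divLoopCode (R : ℕ → ℕ) (p s : ℕ) : List CMInstr :=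
  (List.range (2 * p)).map (fun i => if i % 2 = 0 then .jz 0 (R (i / 2)) else .dec 0) ++
    [.inc 1, .jmp s]

theorem length_divLoopCode (R : ℕ → ℕ) (p s : ℕ) : (divLoopCode R p s).length = 2 * p + 2 := by
  simp [divLoopCode]

/-- Zero tests and decrements alternate, so the test at offset `2 * r` is met after `r` decrements
in the current round and its jump reveals the remainder. -/
theorem reaches_divLoop {R : ℕ → ℕ} {p s : ℕ} (h : P.CodeAt s (divLoopCode R p s)) {r : ℕ}
    (hr : r < p) (q b : ℕ) :
    P.Reaches ![p * q + r, b, s] ![0, b + q, R r] := by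
  have hjz : ∀ i < p, P.instrAt (s + 2 * i) = some (.jz 0 (R i)) := by
    intro i hi
    refine h.left _ _ ?_
    simp [hi]
  have hdec : ∀ i < p, P.instrAt (s + 2 * i + 1) = some (.dec 0) := by
    intro i hi
    rw [add_assoc]
    refine h.left _ _ ?_
    have : 2 * i + 1 < 2 * p := by omega
    simp [this]
  have hend := h.right (t := s + 2 * p) (by simp)
  obtain ⟨hinc, hjmp⟩ := codeAt_cons.1 hend
  have hsub : ∀ i ≤ p, ∀ a b, P.Reaches ![a + i, b, s] ![a, b, s + 2 * i] := by
    intro i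
    induction i with
    | zero => intro _ a b; exact .refl
    | succ i ih =>
      intro hi a b
      have e := ih (by omega) (a + 1) b
      have e1 := step_jz_succ (hjz i (by omega)) a b
      have e2 := step_dec (hdec i (by omega)) a b
      simp only [config_zero] at e1 e2
      rw [add_right_comm] at e
      exact (e.tail e1).tail e2
  induction q generalizing b with
  | zero =>
    have e1 := hsub r hr.le 0 b
    have e2 := step_jz_zero (hjz r hr) b
    rw [config_zero, config_zero] at e2
    rw [zero_add] at e1
    simpa using e1.tail e2
  | succ q ih =>
    have e1 := hsub p le_rfl (p * q + r) b
    have e2 := step_inc_rev (j := 0) hinc (p * q + r) b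
    have e3 := step_jmp hjmp.single 0 (p * q + r) (b + 1)
    simp only [config_zero] at e2 e3
    have h1 : p * (q + 1) + r = p * q + r + p := by ring
    have h2 : b + (q + 1) = b + 1 + q := by ring
    rw [h1, h2]
    exact ((e1.tail e2).tail e3).trans (ih _)

/-- Divides the first register by `p` if it is divisible by `p`, and otherwise jumps to `z`. -/
def divCode (p z s : ℕ) : List CMInstr :=
  divLoopCode (fun r => if r = 0 then s + 2 * p + 2 else s + 2 * p + 7 + (p - 1 - r)) p s ++
    (transferCode 1 1 (s + 2 * p + 2) ++ ([.jmp (s + (4 * p + 10))] ++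
      (List.replicate (p - 1) (.inc 0) ++ (transferCode 1 p (s + 3 * p + 6) ++ [.jmp z]))))

theorem length_divCode {p : ℕ} (hp : 0 < p) (z s : ℕ) : (divCode p z s).length = 4 * p + 10 := by
  simp [divCode, length_transferCode, length_divLoopCode]
  omega

theorem reaches_div_of_dvd {p z s : ℕ} (hp : 0 < p) (h : P.CodeAt s (divCode p z s)) (q : ℕ) :
    P.Reaches ![q * p, 0, s] ![q, 0, s + (4 * p + 10)] := by
  have e1 := reaches_divLoop h.left hp q 0
  rw [if_pos rfl, add_zero, zero_add, mul_comm p] at e1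
  have h2 := h.right (t := s + 2 * p + 2) (by simp [length_divLoopCode]; omega)
  have e2 := reaches_transfer h2.left q 0
  have h3 := h2.right (t := s + 2 * p + 6) (by simp [length_transferCode])
  have e3 := step_jmp h3.left.single 0 q 0
  rw [config_one, config_one, zero_add, one_mul] at e2
  exact (e1.trans e2).tail e3

/-- The failed division is undone: remainder `r` enters the run of `p - 1` increments at offset `p -
1 - r`, so exactly `r` of them are executed, and a transfer with factor `p` restores the rest. -/
theorem reaches_div_of_not_dvd {p z s : ℕ} (hp : 0 < p) (h : P.CodeAt s (divCode p z s)) {a : ℕ}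
    (ha : ¬ p ∣ a) : P.Reaches ![a, 0, s] ![a, 0, z] := by
  obtain ⟨q, r, hr, hr0, rfl⟩ : ∃ q r, r < p ∧ r ≠ 0 ∧ a = p * q + r :=
    ⟨a / p, a % p, Nat.mod_lt _ hp, fun h0 => ha (Nat.dvd_of_mod_eq_zero h0),
      (Nat.div_add_mod a p).symm⟩
  have e1 := reaches_divLoop h.left hr q 0
  rw [if_neg hr0, zero_add] at e1
  have h2 := h.right (t := s + 2 * p + 2) (by simp [length_divLoopCode]; omega)
  have h3 := h2.right (t := s + 2 * p + 6) (by simp [length_transferCode])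
  have h4 := h3.right (t := s + 2 * p + 7) (by simp)
  have hinc : ∀ i < r, P.instrAt (s + 2 * p + 7 + (p - 1 - r) + i) = some (.inc 0) := by
    intro i hi
    rw [add_assoc]
    exact h4.left.replicate _ (by omega)
  have e2 := reaches_inc hinc 0 q
  have h5 := h4.right (t := s + 3 * p + 6) (by simp; omega)
  have haddr : s + 2 * p + 7 + (p - 1 - r) + r = s + 3 * p + 6 := by omega
  rw [config_zero, config_zero, zero_add, haddr] at e2
  have e3 := reaches_transfer h5.left q r
  rw [config_one, config_one, add_comm r] at e3
  have h6 := h5.right (t := s + 3 * p + 6 + p + 3) (by simp [length_transferCode]; omega)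
  have e4 := step_jmp h6.single 0 (p * q + r) 0
  exact ((e1.trans e2).trans e3).tail e4

end CMProgram

/-! ### Gödel numbers and structured programs -/

/-- Contents of infinitely many registers, almost all zero. -/
abbrev RegState := ℕ →₀ ℕ

namespace RegState

open Finsupp

/-- The Gödel number `∏ pᵢ ^ σᵢ` of a state. -/
noncomputable def godel (σ : RegState) : ℕ := σ.prod fun i e => Nat.nth Nat.Prime i ^ e

theorem godel_add (σ τ : RegState) : godel (σ + τ) = godel σ * godel τ :=
  Finsupp.prod_add_index' (by simp) (by intros; exact pow_add _ _ _)

theorem godel_single (i e : ℕ) : godel (single i e) = Nat.nth Nat.Prime i ^ e :=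
  Finsupp.prod_single_index (by simp)

theorem godel_add_single_one (σ : RegState) (i : ℕ) :
    godel (σ + single i 1) = godel σ * Nat.nth Nat.Prime i := by
  rw [godel_add, godel_single, pow_one]

/-- A prime dividing the product divides, hence equals, a prime indexed by the support. This makes
divisibility a test for a nonzero register. -/
theorem not_dvd_godel {σ : RegState} {i : ℕ} (h : σ i = 0) : ¬ Nat.nth Nat.Prime i ∣ godel σ := by
  intro hd
  obtain ⟨j, hj, hdj⟩ := (Nat.prime_nth_prime i).prime.exists_mem_finset_dvd hd
  have h1 := (Nat.prime_nth_prime i).dvd_of_dvd_pow hdj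
  have h2 := (Nat.prime_dvd_prime_iff_eq (Nat.prime_nth_prime i) (Nat.prime_nth_prime j)).1 h1
  have h3 := Nat.nth_injective Nat.infinite_setOfPred_prime h2
  subst h3
  exact (Finsupp.mem_support_iff.1 hj) h

end RegState

/-- Relocatable code of a fixed length. -/
structure Block where
  len : ℕ
  code : ℕ → List CMInstr
  length_code : ∀ s, (code s).length = len

namespace Block

open Finsupp CMProgram RegState

/-- The block transforms the state `σ` into `τ`. -/
def Does (b : Block) (σ τ : RegState) : Prop :=
  ∀ (P : CMProgram) (s : ℕ), P.CodeAt s (b.code s) →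
    P.Reaches ![godel σ, 0, s] ![godel τ, 0, s + b.len]

def skip : Block := ⟨0, fun _ => [], fun _ => rfl⟩

theorem skip_does (σ : RegState) : skip.Does σ σ := fun _ _ _ => .refl

def seq (b c : Block) : Block where
  len := b.len + c.len
  code s := b.code s ++ c.code (s + b.len)
  length_code s := by simp [b.length_code, c.length_code]

theorem Does.seq {b c : Block} {σ τ ρ : RegState} (hb : b.Does σ τ) (hc : c.Does τ ρ) :
    (b.seq c).Does σ ρ := by
  intro P s h
  have e1 := hb P s h.left
  have e2 := hc P _ (h.right (by rw [b.length_code]))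
  rw [add_assoc] at e2
  exact e1.trans e2

/-- Increments register `i`. -/
noncomputable def inc (i : ℕ) : Block where
  len := Nat.nth Nat.Prime i + 7
  code := mulCode (Nat.nth Nat.Prime i)
  length_code := length_mulCode _

theorem inc_does (i : ℕ) (σ : RegState) : (inc i).Does σ (σ + single i 1) := by
  intro P s h
  rw [godel_add_single_one]
  exact reaches_mul h _

/-- While register `i` is nonzero, decrements it and executes `b`. -/
noncomputable def loop (i : ℕ) (b : Block) : Block where
  len := 4 * Nat.nth Nat.Prime i + 10 + (b.len + 1)
  code s := divCode (Nat.nth Nat.Prime i) (s + (4 * Nat.nth Nat.Prime i + 10 + (b.len + 1))) s ++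
    (b.code (s + (4 * Nat.nth Nat.Prime i + 10)) ++ [.jmp s])
  length_code s := by
    simp [length_divCode (Nat.prime_nth_prime i).pos, b.length_code]

/-- The failure target of the division is the address just after the block. -/
theorem loop_does_of_eq_zero {i : ℕ} {b : Block} {σ : RegState} (h : σ i = 0) :
    (loop i b).Does σ σ := by
  intro P s hP
  exact reaches_div_of_not_dvd (Nat.prime_nth_prime i).pos hP.left (not_dvd_godel h)

theorem loop_does_add_single {i : ℕ} {b : Block} {σ τ ρ : RegState} (hb : b.Does σ τ)
    (hloop : (loop i b).Does τ ρ) : (loop i b).Does (σ + single i 1) ρ := by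
  intro P s hP
  have hp := (Nat.prime_nth_prime i).pos
  have e1 := reaches_div_of_dvd hp hP.left (godel σ)
  rw [← godel_add_single_one] at e1
  have h2 := hP.right (t := s + (4 * Nat.nth Nat.Prime i + 10)) (by rw [length_divCode hp])
  have e2 := hb P _ h2.left
  have h3 := h2.right rfl
  rw [b.length_code] at h3
  have e3 := step_jmp h3.single 0 (godel τ) 0
  exact ((e1.trans e2).tail e3).trans (hloop P s hP)

end Block

/-! ### Register operations and primitive recursive functions as blocks -/

namespace Block

open Finsupp CMProgram RegState

theorem Does.of_eq {b : Block} {σ σ' τ τ' : RegState} (h : b.Does σ τ) (hσ : σ = σ') (hτ : τ = τ') :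
    b.Does σ' τ' := hσ ▸ hτ ▸ h

/-- Loop rule: `τ m` is the invariant after `m` rounds, with the `e` rounds still to come kept apart
in register `i`. -/
theorem loop_does {i : ℕ} {b : Block} {k : ℕ} (τ : ℕ → RegState) (h0 : τ k i = 0)
    (hb : ∀ m e, m + e + 1 = k → b.Does (τ m + single i e) (τ (m + 1) + single i e)) :
    (loop i b).Does (τ 0 + single i k) (τ k) := by
  have key : ∀ e m, m + e = k → (loop i b).Does (τ m + single i e) (τ k) := by
    intro e
    induction e with
    | zero =>
      rintro m rfl
      simpa using loop_does_of_eq_zero h0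
    | succ e ih =>
      intro m hm
      have := loop_does_add_single (hb m e (by omega)) (ih (m + 1) (by omega))
      rwa [add_assoc, ← single_add] at this
  exact key k 0 (by simp)

/-- Sets register `i` to zero. -/
noncomputable def clear (i : ℕ) : Block := loop i skip

theorem clear_does {i : ℕ} {σ : RegState} (h : σ i = 0) (k : ℕ) :
    (clear i).Does (σ + single i k) σ :=
  loop_does (fun _ => σ) h fun _ _ _ => skip_does _

/-- Adds register `i` to register `o` and sets register `i` to zero. -/
noncomputable def move (i o : ℕ) : Block := loop i (inc o)

theorem move_does {i o : ℕ} {σ : RegState} (h : σ i = 0) (hio : i ≠ o) (k : ℕ) :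
    (move i o).Does (σ + single i k) (σ + single o k) := by
  have := loop_does (b := inc o) (k := k) (i := i) (fun m => σ + single o m)
    (by simp [h, hio.symm])
    fun m e _ => (inc_does o _).of_eq rfl (by rw [single_add]; abel)
  exact this.of_eq (by simp) rfl

/-- Adds register `i` to register `o`, with the help of an empty register `t`. -/
noncomputable def copy (i t o : ℕ) : Block := (loop i ((inc t).seq (inc o))).seq (move t i)

/-- Reading a register destroys it, so its contents go to both `t` and `o` and then return from `t`.
-/
theorem copy_does {i t o : ℕ} {σ : RegState} (h : σ t = 0) (hit : i ≠ t) (hio : i ≠ o)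
    (hto : t ≠ o) : (copy i t o).Does σ (σ + single o (σ i)) := by
  obtain ⟨ρ, k, hρ, rfl⟩ : ∃ (ρ : RegState) (k : ℕ), ρ i = 0 ∧ ρ + single i k = σ :=
    ⟨σ.erase i, σ i, erase_same, erase_add_single i σ⟩
  have hk : (ρ + single i k) i = k := by simp [hρ]
  have ht : ρ t = 0 := by simpa [single_apply, hit] using h
  rw [hk]
  have e1 := loop_does (b := (inc t).seq (inc o)) (k := k) (i := i)
    (fun m => ρ + single t m + single o m)
    (by simp [hρ, hit.symm, hio.symm])
    fun m e _ => ((inc_does t _).seq (inc_does o _)).of_eq rfl (by simp only [single_add]; abel)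
  have e2 := move_does (i := t) (o := i) (σ := ρ + single o k)
    (by simp [ht, hto.symm]) hit.symm k
  refine (Does.seq (e1.of_eq (by simp) rfl) (e2.of_eq (by abel) rfl)).of_eq rfl (by abel)

/-- The state with contents `w 0, …, w (k - 1)` in the registers `base, …, base + k - 1`. -/
noncomputable def window (base : ℕ) (w : ℕ → ℕ) (k : ℕ) : RegState :=
  ∑ i ∈ Finset.range k, single (base + i) (w i)

theorem window_succ (base : ℕ) (w : ℕ → ℕ) (k : ℕ) :
    window base w (k + 1) = window base w k + single (base + k) (w k) :=
  Finset.sum_range_succ _ _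

theorem window_apply_outside {base k j : ℕ} (w : ℕ → ℕ) (h : j < base ∨ base + k ≤ j) :
    window base w k j = 0 := by
  induction k with
  | zero => simp [window]
  | succ k ih =>
    rw [window_succ, Finsupp.add_apply, ih (by omega), single_apply, if_neg (by omega), add_zero]

theorem window_apply {base k i : ℕ} (w : ℕ → ℕ) (h : i < k) : window base w k (base + i) = w i := by
  induction k with
  | zero => omega
  | succ k ih =>
    rw [window_succ, Finsupp.add_apply, single_apply]
    by_cases hik : i = k
    · subst hik
      rw [window_apply_outside w (by omega), if_pos rfl, zero_add]
    · rw [ih (by omega), if_neg (by omega), add_zero]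

theorem exists_clear_window (base k : ℕ) : ∃ b : Block, ∀ (σ : RegState) (w : ℕ → ℕ),
    (∀ j ≥ base, σ j = 0) → b.Does (σ + window base w k) σ := by
  induction k with
  | zero => exact ⟨skip, fun σ w _ => by simpa [window] using skip_does σ⟩
  | succ k ih =>
    obtain ⟨b, hb⟩ := ih
    refine ⟨(clear (base + k)).seq b, fun σ w hσ => ?_⟩
    rw [window_succ, ← add_assoc]
    refine (clear_does ?_ _).seq (hb σ w hσ)
    rw [Finsupp.add_apply, hσ _ (by omega), window_apply_outside w (by omega)]

/-- The block adds the value of `f` on the registers `ins` to the register `out`, and uses the empty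
registers from `free` on as scratch space. -/
def Computes {n : ℕ} (b : Block) (f : List.Vector ℕ n → ℕ) (ins : Fin n → ℕ) (out free : ℕ) :
    Prop :=
  ∀ σ : RegState, (∀ j ≥ free, σ j = 0) →
    b.Does σ (σ + single out (f (List.Vector.ofFn fun i => σ (ins i))))

/-- The values of the `g i` are collected in the window from `free` on, `f` is run on that window,
and the window is cleared. -/
theorem exists_computes_comp {m n : ℕ} {f : List.Vector ℕ n → ℕ}
    {g : Fin n → List.Vector ℕ m → ℕ} {ins : Fin m → ℕ} {out free : ℕ}
    (hins : ∀ i, ins i < free) (hout : out < free)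
    (hf : ∃ b : Block, b.Computes f (fun i => free + i) out (free + n))
    (hg : ∀ i : Fin n, ∃ b : Block, b.Computes (g i) ins (free + i) (free + n)) :
    ∃ b : Block, b.Computes (fun v => f (List.Vector.ofFn fun i => g i v)) ins out free := by
  let w (v : List.Vector ℕ m) (i : ℕ) : ℕ := if h : i < n then g ⟨i, h⟩ v else 0
  have hgs : ∀ k ≤ n, ∃ b : Block, ∀ σ : RegState, (∀ j ≥ free, σ j = 0) →
      b.Does σ (σ + window free (w (List.Vector.ofFn fun i => σ (ins i))) k) := by
    intro k
    induction k with
    | zero => exact fun _ => ⟨skip, fun σ _ => by simpa [window] using skip_does σ⟩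
    | succ k ih =>
      intro hk
      obtain ⟨b, hb⟩ := ih (by omega)
      obtain ⟨c, hc⟩ := hg ⟨k, hk⟩
      refine ⟨b.seq c, fun σ hσ => ?_⟩
      set v := List.Vector.ofFn fun i => σ (ins i) with hv
      have e := hc (σ + window free (w v) k) fun j hj => by
        rw [Finsupp.add_apply, hσ j (by omega), window_apply_outside _ (by omega)]
      have hv' : (List.Vector.ofFn fun i => (σ + window free (w v) k) (ins i)) = v := by
        rw [hv]
        congr 1
        funext i
        rw [Finsupp.add_apply, window_apply_outside _ (Or.inl (hins i)), add_zero]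
      rw [hv'] at e
      refine (hb σ hσ).seq (e.of_eq rfl ?_)
      rw [window_succ, add_assoc]
      simp [w, show k < n from hk]
  obtain ⟨b, hb⟩ := hgs n le_rfl
  obtain ⟨c, hc⟩ := hf
  obtain ⟨d, hd⟩ := exists_clear_window free n
  refine ⟨(b.seq c).seq d, fun σ hσ => ?_⟩
  set v := List.Vector.ofFn fun i => σ (ins i) with hv
  have e := hc (σ + window free (w v) n) fun j hj => by
    rw [Finsupp.add_apply, hσ j (by omega), window_apply_outside _ (by omega)]
  have hargs : (List.Vector.ofFn fun i : Fin n => (σ + window free (w v) n) (free + i)) =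
      List.Vector.ofFn fun i => g i v := by
    congr 1
    funext i
    rw [Finsupp.add_apply, hσ _ (by omega), window_apply _ i.2, zero_add]
    simp [w]
  rw [hargs] at e
  refine ((hb σ hσ).seq e).seq ((hd (σ + single out _) (w v) fun j hj => ?_).of_eq ?_ rfl)
  · rw [Finsupp.add_apply, hσ j hj, single_apply, if_neg (by omega), add_zero]
  · abel

/-- Register `free` counts down a copy of the recursion argument, `free + 1` counts up the index,
`free + 2` holds the current value and `free + 3` the next one; `free + 4` is scratch for the copy.
-/
theorem exists_computes_prec {n : ℕ} {f : List.Vector ℕ n → ℕ}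
    {g : List.Vector ℕ (n + 2) → ℕ} {ins : Fin (n + 1) → ℕ} {out free : ℕ}
    (hins : ∀ i, ins i < free) (hout : out < free)
    (hf : ∃ b : Block, b.Computes f (fun i => ins i.succ) (free + 2) (free + 5))
    (hg : ∃ b : Block, b.Computes g
      (Fin.cons (free + 1) (Fin.cons (free + 2) fun i => ins i.succ) : Fin (n + 2) → ℕ)
      (free + 3) (free + 5)) :
    ∃ b : Block, b.Computes (fun v : List.Vector ℕ (n + 1) =>
      v.head.rec (f v.tail) fun y IH => g (y ::ᵥ IH ::ᵥ v.tail)) ins out free := by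
  obtain ⟨bf, hbf⟩ := hf
  obtain ⟨bg, hbg⟩ := hg
  let body := ((bg.seq (clear (free + 2))).seq (move (free + 3) (free + 2))).seq (inc (free + 1))
  refine ⟨((((copy (ins 0) (free + 4) free).seq bf).seq (loop free body)).seq
    (move (free + 2) out)).seq (clear (free + 1)), fun σ hσ => ?_⟩
  have h0 : ∀ c, σ (free + c) = 0 := fun c => hσ _ (by omega)
  have hlt : ∀ i, ∀ c, free + c ≠ ins i := fun i c => by have := hins i; omega
  set k := σ (ins 0) with hk
  set v := List.Vector.ofFn fun i => σ (ins i.succ) with hv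
  -- The value after `m` rounds, from which the loop invariant is built.
  let R (m : ℕ) : ℕ := m.rec (f v) fun y IH => g (y ::ᵥ IH ::ᵥ v)
  have hgoal : (List.Vector.ofFn fun i => σ (ins i)).head.rec
      (f (List.Vector.ofFn fun i => σ (ins i)).tail)
      (fun y IH => g (y ::ᵥ IH ::ᵥ (List.Vector.ofFn fun i => σ (ins i)).tail)) = R k := by
    simp only [List.Vector.ofFn, List.Vector.head_cons, List.Vector.tail_cons]
    rfl
  refine Does.of_eq ?_ rfl (congrArg (fun x => σ + single out x) hgoal.symm)
  have e1 : (copy (ins 0) (free + 4) free).Does σ (σ + single free k) :=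
    copy_does (h0 4) (hlt 0 4).symm (hlt 0 0).symm (by omega)
  have e2 := hbf (σ + single free k) fun j hj => by
    rw [Finsupp.add_apply, hσ j (by omega), single_apply, if_neg (by omega), add_zero]
  have hv2 : (List.Vector.ofFn fun i => (σ + single free k) (ins i.succ)) = v := by
    rw [hv]
    congr 1
    funext i
    rw [Finsupp.add_apply, single_apply, if_neg (show free ≠ _ from hlt i.succ 0), add_zero]
  rw [hv2] at e2
  have e3 := loop_does (b := body) (i := free) (k := k)
    (fun m => σ + single (free + 1) m + single (free + 2) (R m))
    (by simp only [Finsupp.add_apply, single_apply, show σ free = 0 from h0 0]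
        split_ifs <;> omega) ?_
  · have e4 := move_does (i := free + 2) (o := out) (σ := σ + single (free + 1) k)
      (by simp only [Finsupp.add_apply, single_apply, h0 2]; split_ifs <;> omega) (by omega) (R k)
    have e5 := clear_does (i := free + 1) (σ := σ + single out (R k))
      (by simp only [Finsupp.add_apply, single_apply, h0 1]; split_ifs <;> omega) k
    exact (((e1.seq e2).seq (e3.of_eq (by simp [R]; abel) rfl)).seq e4).seq
      (e5.of_eq (by abel) rfl)
  · intro m e _
    have d1 := hbg (σ + single (free + 1) m + single (free + 2) (R m) + single free e) fun j hj => by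
      have := hσ j (by omega)
      simp only [Finsupp.add_apply, single_apply, this]
      split_ifs <;> omega
    have hargs : g (List.Vector.ofFn fun i =>
        (σ + single (free + 1) m + single (free + 2) (R m) + single free e)
          ((Fin.cons (free + 1) (Fin.cons (free + 2) fun i => ins i.succ) : Fin (n + 2) → ℕ) i)) =
        R (m + 1) := by
      show _ = g (m ::ᵥ R m ::ᵥ v)
      congr 1
      simp only [List.Vector.ofFn, Fin.cons_zero, Fin.cons_succ]
      congr 1
      · simp [h0 1]
      congr 1
      · simp [h0 2]
      · rw [hv]
        congr 1
        funext i
        have h1 := hlt i.succ 0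
        have h2 := hlt i.succ 1
        have h3 := hlt i.succ 2
        simp only [Finsupp.add_apply, single_apply]
        split_ifs <;> omega
    rw [hargs] at d1
    have d2 := clear_does (i := free + 2)
      (σ := σ + single (free + 1) m + single free e + single (free + 3) (R (m + 1)))
      (by simp only [Finsupp.add_apply, single_apply, h0 2]; split_ifs <;> omega) (R m)
    have d3 := move_does (i := free + 3) (o := free + 2)
      (σ := σ + single (free + 1) m + single free e)
      (by simp only [Finsupp.add_apply, single_apply, h0 3]; split_ifs <;> omega) (by omega) (R (m + 1))
    exact (((d1.seq (d2.of_eq (by abel) rfl)).seq d3).seq (inc_does _ _)).of_eq rfl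
      (by rw [single_add (free + 1)]; abel)

/-- Inputs must differ from the output because a copy empties and refills its source while adding to
its target. -/
theorem exists_computes {n : ℕ} {f : List.Vector ℕ n → ℕ} (hf : Nat.Primrec' f) :
    ∀ (ins : Fin n → ℕ) (out free : ℕ), (∀ i, ins i < free) → out < free → (∀ i, ins i ≠ out) →
      ∃ b : Block, b.Computes f ins out free := by
  induction hf with
  | zero => exact fun _ _ _ _ _ _ => ⟨skip, fun σ _ => by simpa using skip_does σ⟩
  | succ =>
    intro ins out free hins hout hne
    refine ⟨(copy (ins 0) free out).seq (inc out), fun σ hσ => ?_⟩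
    have h1 := hins 0
    refine ((copy_does (hσ _ le_rfl) (by omega) (hne 0) (by omega)).seq
      (inc_does out _)).of_eq rfl ?_
    simp [List.Vector.ofFn, add_assoc, ← single_add]
  | get i =>
    intro ins out free hins hout hne
    refine ⟨copy (ins i) free out, fun σ hσ => ?_⟩
    have h1 := hins i
    refine (copy_does (hσ _ le_rfl) (by omega) (hne i) (by omega)).of_eq rfl ?_
    simp
  | @comp m n f g _ _ ihf ihg =>
    intro ins out free hins hout hne
    exact exists_computes_comp hins hout
      (ihf _ _ _ (fun i => by omega) (by omega) fun i => by omega)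
      fun i => ihg i _ _ _ (fun j => by have := hins j; omega) (by omega)
        fun j => by have := hins j; omega
  | @prec n f g _ _ ihf ihg =>
    intro ins out free hins hout hne
    refine exists_computes_prec hins hout
      (ihf _ _ _ (fun i => by have := hins i.succ; omega) (by omega)
        fun i => by have := hins i.succ; omega)
      (ihg _ _ _ (fun i => ?_) (by omega) fun i => ?_)
    · refine Fin.cases ?_ (Fin.cases ?_ fun i => ?_) i
      · simp
      · simp
      · have := hins i.succ
        simp only [Fin.cons_succ]
        omega
    · refine Fin.cases ?_ (Fin.cases ?_ fun i => ?_) i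
      · simp
      · simp
      · have := hins i.succ
        simp only [Fin.cons_succ]
        omega

end Block

/-! ### Undecidability of the halting problem of two-counter machines -/

namespace CMProgram

open Finsupp RegState Block

/-! ### Determinism and termination of runs -/

variable {P : CMProgram}

theorem Step.deterministic {x y z : Triple} (hy : P.Step x y) (hz : P.Step x z) : y = z := by
  obtain ⟨ι, hι, ey⟩ := hy
  obtain ⟨κ, hκ, ez⟩ := hz
  obtain rfl : ι = κ := by simpa [hι] using hκ
  have key : ∀ j : Fin 2, y j.castSucc = z j.castSucc → y j.rev.castSucc = z j.rev.castSucc →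
      y 2 = z 2 → y = z := by
    intro j h1 h2 h3
    funext l
    fin_cases j <;> fin_cases l <;> assumption
  cases ι with
  | inc j =>
    exact key j (ey.1.trans ez.1.symm) (ey.2.1.trans ez.2.1.symm) (ey.2.2.trans ez.2.2.symm)
  | dec j =>
    exact key j (Nat.succ_injective (ey.1.trans ez.1.symm)) (ey.2.1.trans ez.2.1.symm)
      (ey.2.2.trans ez.2.2.symm)
  | jz j z =>
    exact key 0 (ey.1.trans ez.1.symm) (ey.2.1.trans ez.2.1.symm) (ey.2.2.trans ez.2.2.symm)
  | jmp z =>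
    exact key 0 (ey.1.trans ez.1.symm) (ey.2.1.trans ez.2.1.symm) (ey.2.2.trans ez.2.2.symm)

theorem acc_of_halted {x : Triple} (h : P.instrAt (x 2) = none) : Acc (fun b a => P.Step a b) x :=
  ⟨_, fun _ ⟨_, hι, _⟩ => by simp [h] at hι⟩

/-- Accessibility for the reversed step relation says that no infinite run starts here. By
determinism the halting run is the only run, so it excludes infinite ones. -/
theorem acc_of_reaches {x y : Triple} (h : P.Reaches x y) (hy : P.instrAt (y 2) = none) :
    Acc (fun b a => P.Step a b) x := by
  induction h using Relation.ReflTransGen.head_induction_on with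
  | refl => exact acc_of_halted hy
  | head hs _ ih => exact ⟨_, fun z hz => (hs.deterministic hz) ▸ ih⟩

theorem acc_of_acc {x y : Triple} (h : P.Reaches x y) (hx : Acc (fun b a => P.Step a b) x) :
    Acc (fun b a => P.Step a b) y := by
  induction h with
  | refl => exact hx
  | tail _ hs ih => exact ih.inv hs

theorem not_acc_of_chain (c : ℕ → Triple) (h : ∀ m, Relation.TransGen P.Step (c m) (c (m + 1))) :
    ¬ Acc (fun b a => P.Step a b) (c 0) := by
  intro hacc
  have key : ∀ x, Acc (Relation.TransGen fun b a => P.Step a b) x → ∀ m, c m ≠ x := by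
    intro x hx
    induction hx with
    | intro x _ ih =>
      rintro m rfl
      refine ih (c (m + 1)) ?_ (m + 1) rfl
      exact Relation.transGen_swap.2 (h m)
  exact key _ hacc.transGen 0 rfl

theorem codeAt_append_of_length {C D E : List CMInstr} {s : ℕ} (hs : s = C.length + 1) :
    CodeAt (C ++ (D ++ E)) s D := by
  intro i ι hi
  subst hs
  have h1 := (List.getElem?_eq_some_iff.1 hi).1
  rw [add_right_comm, instrAt_succ, List.getElem?_append_right (by omega), Nat.add_sub_cancel_left,
    List.getElem?_append_left h1]
  exact hi

/-- The search loop, at address `2`: computes a value in register `2`, halts if it is zero, and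
otherwise increments register `1` and repeats. -/
noncomputable def searchCode (b : Block) : List CMInstr :=
  b.code 2 ++ (divCode (Nat.nth Nat.Prime 2) 0 (2 + b.len) ++
    (((clear 2).seq (inc 1)).code (2 + b.len + (4 * Nat.nth Nat.Prime 2 + 10)) ++ [.jmp 2]))

/-! ### Unbounded search on a two-counter machine -/

section Search

variable {b : Block} {f : ℕ → ℕ → ℕ}

theorem reaches_search_value
    (hb : b.Computes (fun v : List.Vector ℕ 2 => f v.head v.tail.head) ![1, 0] 2 3)
    (hP : P.CodeAt 2 (searchCode b)) (n m : ℕ) :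
    P.Reaches ![godel (single 0 n + single 1 m), 0, 2]
      ![godel (single 0 n + single 1 m + single 2 (f m n)), 0, 2 + b.len] := by
  have e := hb (single 0 n + single 1 m) (fun j hj => by
    simp only [Finsupp.add_apply, single_apply]
    split_ifs <;> omega) P 2 hP.left
  simpa [List.Vector.ofFn, single_apply] using e

/-- If the value is zero, the division by the prime of register `2` fails and jumps to `0`, which is
no instruction number. -/
theorem reaches_search_halt
    (hb : b.Computes (fun v : List.Vector ℕ 2 => f v.head v.tail.head) ![1, 0] 2 3)
    (hP : P.CodeAt 2 (searchCode b)) {n m : ℕ} (h : f m n = 0) :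
    ∃ a, P.Reaches ![godel (single 0 n + single 1 m), 0, 2] ![a, 0, 0] := by
  have e1 := reaches_search_value hb hP n m
  rw [h, single_zero, add_zero] at e1
  have h2 := hP.right (t := 2 + b.len) (by rw [b.length_code])
  have e2 := reaches_div_of_not_dvd (Nat.prime_nth_prime 2).pos h2.left
    (not_dvd_godel (σ := single 0 n + single 1 m) (i := 2) (by simp))
  exact ⟨_, e1.trans e2⟩

/-- A nonzero value passes the division, which uses up one unit; `clear 2` removes the rest before
the next candidate is tried. `TransGen` records that at least one step is made, so infinitely many
rounds form an infinite run. -/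
theorem transGen_search_next
    (hb : b.Computes (fun v : List.Vector ℕ 2 => f v.head v.tail.head) ![1, 0] 2 3)
    (hP : P.CodeAt 2 (searchCode b)) {n m : ℕ} (h : f m n ≠ 0) :
    Relation.TransGen P.Step ![godel (single 0 n + single 1 m), 0, 2]
      ![godel (single 0 n + single 1 (m + 1)), 0, 2] := by
  have hp := (Nat.prime_nth_prime 2).pos
  obtain ⟨r, hr⟩ := Nat.exists_eq_succ_of_ne_zero h
  have e1 := reaches_search_value hb hP n m
  rw [hr, Nat.succ_eq_add_one, single_add, ← add_assoc, godel_add_single_one] at e1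
  have h2 := hP.right (t := 2 + b.len) (by rw [b.length_code])
  have e2 := reaches_div_of_dvd hp h2.left (godel (single 0 n + single 1 m + single 2 r))
  have h3 := h2.right rfl
  rw [length_divCode hp] at h3
  have e3 := (clear_does (i := 2) (σ := single 0 n + single 1 m)
    (by simp) r).seq (inc_does 1 _) P _ h3.left
  have h4 := h3.right rfl
  rw [Block.length_code] at h4
  have e4 := step_jmp h4.single 0 (godel (single 0 n + single 1 m + single 1 1)) 0
  rw [config_zero, config_zero, add_assoc (single 0 n), ← single_add] at e4
  rw [add_assoc (single 0 n) (single 1 m) (single 1 1), ← single_add] at e3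
  exact Relation.TransGen.tail' ((e1.trans e2).trans e3) e4

end Search

/-- Jumps to the end, loads `2 ^ n` into the first register, and starts the code at address `2`. -/
def loader (C : List CMInstr) (n : ℕ) : CMProgram :=
  [.jmp (C.length + 2)] ++ (C ++ (List.replicate (2 ^ n) (.inc 0) ++ [.jmp 2]))

theorem codeAt_loader (C : List CMInstr) (n : ℕ) : (loader C n).CodeAt 2 C :=
  codeAt_append_of_length rfl

theorem reaches_loader (C : List CMInstr) (n : ℕ) :
    (loader C n).Reaches ![0, 0, 1] ![2 ^ n, 0, 2] := by
  have hall : (loader C n).CodeAt 1 (loader C n) := by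
    have := codeAt_append_of_length (C := []) (D := loader C n) (E := []) (s := 1) rfl
    simpa using this
  have e1 := step_jmp hall.left.single 0 0 0
  have h2 := (hall.right (t := 2) rfl).right (t := C.length + 2) (by omega)
  have e2 := reaches_inc h2.left.replicate 0 0
  have e3 := step_jmp (h2.right (t := C.length + 2 + 2 ^ n) (by simp)).single 0 (2 ^ n) 0
  rw [zero_add] at e2
  exact ((Relation.ReflTransGen.single e1).trans e2).tail e3

theorem halts_loader_searchCode_iff {b : Block} {f : ℕ → ℕ → ℕ}
    (hb : b.Computes (fun v : List.Vector ℕ 2 => f v.head v.tail.head) ![1, 0] 2 3) (n : ℕ) :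
    (loader (searchCode b) n).Halts ↔ ∃ m, f m n = 0 := by
  have hP := codeAt_loader (searchCode b) n
  have hstart := reaches_loader (searchCode b) n
  -- The loaded number encodes `n` in register `0` and the first candidate `0` in register `1`.
  have hgodel : (2 : ℕ) ^ n = godel (single 0 n + single 1 0) := by
    rw [single_zero, add_zero, godel_single, Nat.nth_prime_zero_eq_two]
  rw [hgodel] at hstart
  by_cases hex : ∃ m, f m n = 0
  · refine iff_of_true ?_ hex
    classical
    have hreach : ∀ m ≤ Nat.find hex, (loader (searchCode b) n).Reaches ![0, 0, 1]
        ![godel (single 0 n + single 1 m), 0, 2] := by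
      intro m
      induction m with
      | zero => exact fun _ => hstart
      | succ m ih =>
        exact fun hm => (ih (by omega)).trans
          (transGen_search_next hb hP (Nat.find_min hex (by omega))).to_reflTransGen
    obtain ⟨a, ha⟩ := reaches_search_halt hb hP (Nat.find_spec hex)
    exact ⟨_, (hreach _ le_rfl).trans ha, rfl⟩
  · refine iff_of_false ?_ hex
    rintro ⟨x, hx, hn⟩
    exact not_acc_of_chain (fun m => ![godel (single 0 n + single 1 m), 0, 2])
      (fun m => transGen_search_next hb hP fun h => hex ⟨m, h⟩)
      (acc_of_acc hstart (acc_of_reaches hx hn))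

open Primrec in
-- Only the number of increments depends on `n`; `C` is a constant, so it does not matter that it is
-- obtained by a noncomputable choice.
theorem primrec_loader (C : List CMInstr) : Primrec (loader C) := by
  have hrep : Primrec fun n : ℕ => List.replicate (2 ^ n) (CMInstr.inc 0) :=
    (list_map (list_range.comp (primrec_nat_pow.comp (const 2) Primrec.id))
      (const (CMInstr.inc 0)).to₂).of_eq fun n => by simp [List.map_const']
  exact list_append.comp (const _) (list_append.comp (const _) (list_append.comp hrep (const _)))

open Nat.Partrec in
theorem not_computablePred_halts : ¬ ComputablePred Halts := by
  -- The search for a zero of `f · n` looks for a bound `m` within which code `n` halts on input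
  -- `0`.
  let f (m n : ℕ) : ℕ := if (Code.evaln m (Denumerable.ofNat Code n) 0).isSome then 0 else 1
  have hf : Primrec₂ f := by
    have h1 : Primrec fun p : ℕ × ℕ => Code.evaln p.1 (Denumerable.ofNat Code p.2) 0 :=
      Code.primrec_evaln.comp
        ((Primrec.fst.pair ((Primrec.ofNat Code).comp Primrec.snd)).pair (Primrec.const 0))
    exact Primrec.ite (Primrec.eq.comp (Primrec.option_isSome.comp h1) (Primrec.const true))
      (Primrec.const 0) (Primrec.const 1)
  obtain ⟨b, hb⟩ := exists_computes (Nat.Primrec'.prim_iff₂.2 hf) ![1, 0] 2 3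
    (by simp [Fin.forall_fin_two]) (by norm_num) (by simp [Fin.forall_fin_two])
  intro hdec
  refine ComputablePred.halting_problem 0 ?_
  have hred : Computable fun c : Code => loader (searchCode b) (Encodable.encode c) :=
    ((primrec_loader _).comp Primrec.encode).to_comp
  obtain ⟨d, hd, hdH⟩ := ComputablePred.computable_iff.1 hdec
  refine ComputablePred.computable_iff.2 ⟨_, hd.comp hred, ?_⟩
  funext c
  refine propext ?_
  have h1 : (loader (searchCode b) (Encodable.encode c)).Halts ↔ _ := (congrFun hdH _).to_iff
  refine Iff.trans ?_ h1
  rw [halts_loader_searchCode_iff hb]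
  simp only [f, Denumerable.ofNat_encode, ite_eq_left_iff, one_ne_zero, imp_false, not_not,
    Part.dom_iff_mem, Code.evaln_complete, Option.isSome_iff_exists, Option.mem_def]
  exact exists_comm

end CMProgram

/-- Current-state opacity of extended finite automata is undecidable, although satisfiability of the
predicates that occur in them is decidable; it remains undecidable for four-state automata of the
simple shape `IsSimple`, to which the halting problem of two-counter machines reduces. -/
theorem theorem1 :
    -- satisfiability of the predicates is decidable
    ComputablePred (fun p : Formula × ℕ => p.1.IsSat p.2) ∧
    -- current-state opacity is undecidable
    ¬ ComputablePred (fun I : OpacityInstance 4 4 => I.Opaque) ∧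
    -- it is undecidable even on simple instances
    (¬ ∃ d : OpacityInstance 4 4 → Bool, Computable d ∧
      ∀ I : OpacityInstance 4 4, I.IsSimple → (d I = true ↔ I.Opaque)) ∧
    -- halting of two-counter machines reduces to reachability of `q₃` and to opacity
    (∃ f : CMProgram → OpacityInstance 4 4, Computable f ∧
      ∀ P : CMProgram, (f P).IsSimple ∧
        (P.Halts ↔ (f P).toEFA.Reachable 3) ∧ (P.Halts ↔ (f P).Opaque)) := by
  have hsimple : ¬ ∃ d : OpacityInstance 4 4 → Bool, Computable d ∧
      ∀ I : OpacityInstance 4 4, I.IsSimple → (d I = true ↔ I.Opaque) := by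
    rintro ⟨d, hd, hdI⟩
    refine CMProgram.not_computablePred_halts (ComputablePred.computable_iff.2
      ⟨_, hd.comp CMProgram.primrec_toInstance.to_comp, ?_⟩)
    funext P
    exact propext ((CMProgram.halts_iff_reachable.trans CMProgram.reachable_iff_opaque).trans
      (hdI _ P.isSimple_toInstance).symm)
  refine ⟨Formula.computablePred_isSat, ?_, hsimple, CMProgram.toInstance,
    CMProgram.primrec_toInstance.to_comp, fun P => ⟨P.isSimple_toInstance,
      CMProgram.halts_iff_reachable,
      CMProgram.halts_iff_reachable.trans CMProgram.reachable_iff_opaque⟩⟩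
  rintro ⟨_, hd⟩
  exact hsimple ⟨_, hd, fun I _ => decide_eq_true_iff⟩
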